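/- **Theorem (invariance of the pattern equivariant representation variety).** Let $d\ge 0$, let $G$ be a topological group (for instance any group with the discrete topology), and let $T$, $T'$ be tilings of $\mathbb{R}^d$ of finite local complexity, with tiling spaces $\Omega_T$, $\Omega_{T'}$. Let $f:\Omega_T\to\Omega_{T'}$ be a homeomorphism. Then there are a bijection $f^*:PREP(T')\to PREP(T)$ and an $\varepsilon_0>0$ such that for all $0<\varepsilon\le\varepsilon_0$: 1. there is a continuous local map $f_\varepsilon:\Omega_T\to\Omega_{T'}$ that is smooth along translational leaves and such that, for every $S\in\Omega_T$, $f_\varepsilon(S)=f(S)-w$ for some $w\in\mathbb{R}^d$ with $|w|<\varepsilon$; 2. for every continuous local map $f_\varepsilon$ with this gap property (smooth or not), every flat PE principal $G$-bundle $P'$ over $T'$ has a pullback $P$ along $f_\varepsilon$ that is a flat PE principal $G$-bundle over $T$, and $f^*[P']=[P]$ for every such pullback $P$; 3. if moreover $f_\varepsilon$ maps the orbit of $T$ to the orbit of $T'$ through a continuous $a:\mathbb{R}^d\to\mathbb{R}^d$, that is $f_\varepsilon(T-x)=T'-a(x)$ for all $x$, then every $P'$ has a pullback $a^*P'$ (the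 usual pullback bundle, with the pulled back charts) that is a flat PE principal $G$-bundle over $T$, and $f^*[P']=[a^*P']$. In particular $f^*$ does not depend on $\varepsilon$ or on the choice of $f_\varepsilon$, and $PREP$ is a topological invariant of the tiling space. *Definitions.* A tile is a nonempty compact set equal to the closure of its interior, with a label; a tiling is a locally finite set of tiles with pairwise disjoint interiors covering $\mathbb{R}^d$. The patch $[B_t(x)]$ of $T$ is the set of tiles that meet the open ball $B_t(x)$, and $T|_t:=[B_t(0)]$. $T$ has finite local complexity if for each $t>0$ it has finitely many patches $[B_t(x)]$ up to translation. $\Omega_T$ is the closure of $\{T-x:x\in\mathbb{R}^d\}$ in the topology in which $S'$ is $\varepsilon$-close to $S$ if $(S'-w)|_{1/\varepsilon}=S|_{1/\varepsilon}$ for some $|w|<\varepsilon$. A map $g:\Omega_T\to\Omega_{T'}$ is local if for every $s>0$ there is $r>0$ such that $S_1|_r=S_2|_r$ implies $g(S_1)|_s=g(S_2)|_s$; it is smooth along leaves if for each $S$ there is a smooth $a_S:\mathbb{R}^d\to\mathbb{R}^d$ with $g(S-x)=g(S)-a_S(x)$ for all $x$. A set $U\subseteq\mathbb{R}^d$ is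 PE with radius $t$ if $x\in U$ and $[B_t(x)]-x=[B_t(y)]-y$ imply $y\in U$; a function $h$ on $U$ is PE with radius $t$ if $h(x)=h(y)$ for all such $x,y\in U$. A flat PE principal $G$-bundle over $T$ with radius $t>0$ is a bundle over $\mathbb{R}^d$ with fibre $G$ and an atlas whose chart domains $U_i$ form an open cover by PE sets of radius $t$, and whose transition functions $h_{ji}:U_i\cap U_j\to G$, acting by left multiplication, are locally constant and PE with radius $t$. Two such bundles, of radii $p$ and $r$, are equivalent if for some $s\ge p,r$ there is a homeomorphism between them over $\mathbb{R}^d$ that in every pair of charts is left multiplication by a locally constant function that is PE with radius $s$. $PREP(T)$ is the set of equivalence classes. Let $P'$ have radius $s$, charts on $U'_i$ and transition functions $h'_{ji}$. A pullback of $P'$ along $g$ is a flat PE principal $G$-bundle over $T$ (of some radius) with charts, indexed by the same set, on $$U_i=\{x: g(T-x)|_s=(T'-y)|_s\text{ for some }y\in U_i'\}$$ and transition functions $h_{ji}(x)=h'_{ji}(y)$ whenever $g(T-x)|_s=(T'-y)|_s$ with $y\in U_i'\cap U_j'$. When $g(T-x)=T'-a(x)$ these are $a^{-1}(U'_i)$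 and $h'_{ji}\circ a$. -/

import Mathlib

open Set Topology
open scoped ContDiff

namespace PETiling

universe u v

/-- `ℝ^d` with its Euclidean norm. -/
abbrev E (d : ℕ) : Type := EuclideanSpace ℝ (Fin d)

/-- A labelled tile: a nonempty compact subset of `ℝ^d` that is the closure of its interior,
together with a label. -/
@[ext]
structure Tile (d : ℕ) (L : Type v) where
  support : Set (E d)
  label : L
  isCompact : IsCompact support
  regular : closure (interior support) = support
  nonempty : support.Nonempty

variable {d : ℕ} {L : Type v}

theorem preimage_add_isCompact {s : Set (E d)} (hs : IsCompact s) (x : E d) :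
    IsCompact ((fun y => y + x) ⁻¹' s) :=
  (Homeomorph.addRight x).isCompact_preimage.2 hs

theorem preimage_add_interior (s : Set (E d)) (x : E d) :
    interior ((fun y => y + x) ⁻¹' s) = (fun y => y + x) ⁻¹' interior s :=
  ((Homeomorph.addRight x).preimage_interior s).symm

theorem preimage_add_closure (s : Set (E d)) (x : E d) :
    closure ((fun y => y + x) ⁻¹' s) = (fun y => y + x) ⁻¹' closure s :=
  ((Homeomorph.addRight x).preimage_closure s).symm

/-- The translated tile `τ - x`. -/
def Tile.shift (τ : Tile d L) (x : E d) : Tile d L where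
  support := (fun y => y + x) ⁻¹' τ.support
  label := τ.label
  isCompact := preimage_add_isCompact τ.isCompact x
  regular := by rw [preimage_add_interior, preimage_add_closure, τ.regular]
  nonempty := by
    obtain ⟨y, hy⟩ := τ.nonempty
    exact ⟨y - x, by simpa using hy⟩

/-- A tiling of `ℝ^d`: a locally finite collection of labelled tiles that cover `ℝ^d` and have
pairwise disjoint interiors. -/
@[ext]
structure Tiling (d : ℕ) (L : Type v) where
  tiles : Set (Tile d L)
  covers : ∀ y : E d, ∃ τ ∈ tiles, y ∈ τ.support
  disjoint : ∀ σ ∈ tiles, ∀ τ ∈ tiles, σ ≠ τ →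
    Disjoint (interior σ.support) (interior τ.support)
  locallyFinite : ∀ r : ℝ, {τ ∈ tiles | (τ.support ∩ Metric.ball 0 r).Nonempty}.Finite

namespace Tiling

/-- The translated tiling `T - x`, in which the point `x` of `T` sits at the origin. -/
def shift (T : Tiling d L) (x : E d) : Tiling d L where
  tiles := (fun τ => τ.shift x) '' T.tiles
  covers := by
    intro y
    obtain ⟨τ, hτ, hy⟩ := T.covers (y + x)
    exact ⟨τ.shift x, ⟨τ, hτ, rfl⟩, hy⟩
  disjoint := by
    rintro _ ⟨σ, hσ, rfl⟩ _ ⟨τ, hτ, rfl⟩ hne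
    have h := T.disjoint σ hσ τ hτ (fun h => hne (by rw [h]))
    simp only [Tile.shift, preimage_add_interior]
    exact h.preimage _
  locallyFinite := by
    intro r
    refine ((T.locallyFinite (r + ‖x‖)).image (fun τ => τ.shift x)).subset ?_
    rintro _ ⟨⟨τ, hτ, rfl⟩, y, hy, hyr⟩
    refine ⟨τ, ⟨hτ, y + x, hy, ?_⟩, rfl⟩
    rw [mem_ball_zero_iff] at hyr ⊢
    exact lt_of_le_of_lt (norm_add_le y x) (by linarith)

/-- The patch `[B_r(0)]` of `T`: the tiles of `T` that meet the open ball of radius `r` about the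
origin.  Hence `(T.shift x).patch r` is the recentred patch `[B_r(x)] - x` of `T`, and
`S₁|_r = S₂|_r` reads `S₁.patch r = S₂.patch r`. -/
def patch (T : Tiling d L) (r : ℝ) : Set (Tile d L) :=
  {τ ∈ T.tiles | (τ.support ∩ Metric.ball 0 r).Nonempty}

theorem patch_eq_of_le {T S : Tiling d L} {r s : ℝ} (hrs : r ≤ s) (h : T.patch s = S.patch s) :
    T.patch r = S.patch r := by
  have key : ∀ A B : Tiling d L, A.patch s = B.patch s → A.patch r ⊆ B.patch r := by
    intro A B hAB τ hτ
    have h1 : τ ∈ B.patch s := by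
      rw [← hAB]
      exact ⟨hτ.1, hτ.2.mono (inter_subset_inter_right _ (Metric.ball_subset_ball hrs))⟩
    exact ⟨h1.1, hτ.2⟩
  exact Subset.antisymm (key T S h) (key S T h.symm)

/-- `S'` is `ε`-close to `S`: a translate of `S'` by less than `ε` has the same patch of radius
`1/ε` about the origin as `S`. -/
def Near (ε : ℝ) (S S' : Tiling d L) : Prop :=
  ∃ w : E d, ‖w‖ < ε ∧ (S'.shift w).patch (1 / ε) = S.patch (1 / ε)

theorem Near.mono {δ ε : ℝ} (hδ : 0 < δ) (h : δ ≤ ε) {S S' : Tiling d L} (hn : Near δ S S') :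
    Near ε S S' := by
  obtain ⟨w, hw, he⟩ := hn
  exact ⟨w, lt_of_lt_of_le hw h, patch_eq_of_le (one_div_le_one_div_of_le hδ h) he⟩

/-- The tiling topology, in which the sets `{S' | Near ε S S'}`, `ε > 0`, form a neighbourhood
basis of `S`. -/
instance : TopologicalSpace (Tiling d L) where
  IsOpen U := ∀ S ∈ U, ∃ ε > 0, ∀ S', Near ε S S' → S' ∈ U
  isOpen_univ := fun _ _ => ⟨1, one_pos, fun _ _ => mem_univ _⟩
  isOpen_inter := by
    intro U V hU hV S hS
    obtain ⟨δ, hδ, h1⟩ := hU S hS.1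
    obtain ⟨ε, hε, h2⟩ := hV S hS.2
    have hm : 0 < min δ ε := lt_min hδ hε
    exact ⟨min δ ε, hm, fun S' h => ⟨h1 S' (h.mono hm (min_le_left _ _)),
      h2 S' (h.mono hm (min_le_right _ _))⟩⟩
  isOpen_sUnion := by
    intro C hC S hS
    obtain ⟨U, hU, hSU⟩ := hS
    obtain ⟨ε, hε, h⟩ := hC U hU S hSU
    exact ⟨ε, hε, fun S' hS' => ⟨U, hU, h S' hS'⟩⟩

/-- Finite local complexity: for every radius `r` there are, up to translation, only finitely many
patches `[B_r(x)]` in `T`. -/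
def FLC (T : Tiling d L) : Prop :=
  ∀ r : ℝ, 0 < r → ∃ F : Set (Set (Tile d L)), F.Finite ∧
    ∀ x : E d, ∃ p ∈ F, ∃ w : E d, (T.shift x).patch r = (fun τ => τ.shift w) '' p

/-- The tiling space `Ω_T`: the closure of the translational orbit of `T`. -/
def Hull (T : Tiling d L) : Set (Tiling d L) := closure (range T.shift)

/-- The point `T - x` of `Ω_T`. -/
def orbitPt (T : Tiling d L) (x : E d) : T.Hull := ⟨T.shift x, subset_closure ⟨x, rfl⟩⟩

/-- `U` is pattern equivariant with radius `t`: with `x` it contains all `y` such that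
`[B_t(x)] - x = [B_t(y)] - y`. -/
def IsPESet (T : Tiling d L) (t : ℝ) (U : Set (E d)) : Prop :=
  ∀ x ∈ U, ∀ y, (T.shift x).patch t = (T.shift y).patch t → y ∈ U

/-- `h` is a pattern equivariant function with radius `t` on `U`. -/
def IsPEOn {α : Type*} (T : Tiling d L) (t : ℝ) (h : E d → α) (U : Set (E d)) : Prop :=
  ∀ x ∈ U, ∀ y ∈ U, (T.shift x).patch t = (T.shift y).patch t → h x = h y

end Tiling

/-- `h` is locally constant on the open set `U`. -/
def IsLocConstOn {α : Type*} (h : E d → α) (U : Set (E d)) : Prop :=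
  ∀ x ∈ U, ∀ᶠ y in 𝓝 x, h y = h x

/-- A flat pattern equivariant principal `G`-bundle over the tiling `T`, with a radius and an atlas.
The domains of the charts are a pattern equivariant open cover of `ℝ^d`, the fibre is `G`, and the
transition functions act by left multiplication, are pattern equivariant and locally constant.
(Domains of trivializations are open, and the charts make `proj` continuous and onto.) -/
structure FlatPEBundle (T : Tiling d L) (G : Type u) [Group G] [TopologicalSpace G] where
  Total : Type u
  [topTotal : TopologicalSpace Total]
  proj : Total → E d
  radius : ℝ
  radius_pos : 0 < radius
  ι : Type
  chart : ι → Bundle.Trivialization G proj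
  covers : ∀ x : E d, ∃ i, x ∈ (chart i).baseSet
  isPE_baseSet : ∀ i, T.IsPESet radius (chart i).baseSet
  /-- `trans j i` is the transition function from chart `i` to chart `j`; only its values on the
  intersection of the two domains matter. -/
  trans : ι → ι → E d → G
  chart_eq : ∀ i j p, proj p ∈ (chart i).baseSet → proj p ∈ (chart j).baseSet →
    (chart j p).2 = trans j i (proj p) * (chart i p).2
  isPE_trans : ∀ i j, T.IsPEOn radius (trans j i) ((chart i).baseSet ∩ (chart j).baseSet)
  flat_trans : ∀ i j, IsLocConstOn (trans j i) ((chart i).baseSet ∩ (chart j).baseSet)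

namespace FlatPEBundle

variable {T : Tiling d L} {G : Type u} [Group G] [TopologicalSpace G]

attribute [instance] FlatPEBundle.topTotal

/-- `P` and `R` are isomorphic as flat pattern equivariant principal bundles of radius `s`: there is
a homeomorphism of the total spaces over the identity of `ℝ^d` which, read in any chart of `P` and
any chart of `R`, is left multiplication by a locally constant pattern equivariant function of
radius `s`. -/
def IsoAt (s : ℝ) (P R : FlatPEBundle T G) : Prop :=
  ∃ Θ : P.Total ≃ₜ R.Total, (∀ p, R.proj (Θ p) = P.proj p) ∧
    ∀ i k, ∃ l : E d → G,
      T.IsPEOn s l ((P.chart i).baseSet ∩ (R.chart k).baseSet) ∧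
      IsLocConstOn l ((P.chart i).baseSet ∩ (R.chart k).baseSet) ∧
      ∀ p, P.proj p ∈ (P.chart i).baseSet → P.proj p ∈ (R.chart k).baseSet →
        (R.chart k (Θ p)).2 = l (P.proj p) * (P.chart i p).2

/-- Equivalence of flat pattern equivariant bundles: they become isomorphic at some radius that is
at least as large as both of their radii. -/
def Equivalent (P R : FlatPEBundle T G) : Prop :=
  ∃ s : ℝ, P.radius ≤ s ∧ R.radius ≤ s ∧ IsoAt s P R

theorem exists_proj_eq (P : FlatPEBundle T G) {i : P.ι} {x : E d}
    (hx : x ∈ (P.chart i).baseSet) : ∃ p, P.proj p = x ∧ (P.chart i p).2 = 1 := by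
  have hm : (x, (1 : G)) ∈ (P.chart i).target := (P.chart i).mem_target.2 hx
  refine ⟨(P.chart i).toOpenPartialHomeomorph.symm (x, 1), (P.chart i).proj_symm_apply hm, ?_⟩
  rw [(P.chart i).apply_symm_apply hm]

theorem Equivalent.refl (P : FlatPEBundle T G) : Equivalent P P :=
  ⟨P.radius, le_rfl, le_rfl, Homeomorph.refl _, fun _ => rfl, fun i k =>
    ⟨P.trans k i, P.isPE_trans i k, P.flat_trans i k, fun p h1 h2 => P.chart_eq i k p h1 h2⟩⟩

theorem Equivalent.symm {P R : FlatPEBundle T G} (h : Equivalent P R) : Equivalent R P := by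
  obtain ⟨s, h1, h2, Θ, hΘ, hl⟩ := h
  have hΘ' : ∀ q, P.proj (Θ.symm q) = R.proj q := fun q => by
    rw [← hΘ, Θ.apply_symm_apply]
  refine ⟨s, h2, h1, Θ.symm, hΘ', fun k i => ?_⟩
  obtain ⟨l, hpe, hflat, he⟩ := hl i k
  refine ⟨fun x => (l x)⁻¹, fun x hx y hy hxy => ?_, fun x hx => ?_, fun q hk hi => ?_⟩
  · simp only [hpe x hx.symm y hy.symm hxy]
  · filter_upwards [hflat x hx.symm] with y hy
    rw [hy]
  · have := he (Θ.symm q) (by rwa [hΘ']) (by rwa [hΘ'])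
    rw [Θ.apply_symm_apply, hΘ'] at this
    rw [this, inv_mul_cancel_left]

theorem Equivalent.trans {P R Q : FlatPEBundle T G} (h : Equivalent P R) (h' : Equivalent R Q) :
    Equivalent P Q := by
  obtain ⟨s, h1, h2, Θ, hΘ, hl⟩ := h
  obtain ⟨s', h1', h2', Θ', hΘ', hl'⟩ := h'
  refine ⟨max s s', h1.trans (le_max_left _ _), h2'.trans (le_max_right _ _), Θ.trans Θ',
    fun p => by simp [hΘ, hΘ'], fun i m => ?_⟩
  choose l hpe hflat he using fun k => hl i k
  choose l' hpe' hflat' he' using fun k => hl' k m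
  choose κ hκ using R.covers
  set n : E d → G := fun x => l' (κ x) x * l (κ x) x with hn
  have comp : ∀ k p, P.proj p ∈ (P.chart i).baseSet → P.proj p ∈ (Q.chart m).baseSet →
      P.proj p ∈ (R.chart k).baseSet →
      (Q.chart m (Θ' (Θ p))).2 = l' k (P.proj p) * l k (P.proj p) * (P.chart i p).2 := by
    intro k p hi hm hk
    rw [he' k (Θ p) (by rwa [hΘ]) (by rwa [hΘ]), he k p hi hk, hΘ, mul_assoc]
  have key : ∀ k x, x ∈ (P.chart i).baseSet → x ∈ (Q.chart m).baseSet →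
      x ∈ (R.chart k).baseSet → n x = l' k x * l k x := by
    intro k x hi hm hk
    obtain ⟨p, rfl, -⟩ := P.exists_proj_eq hi
    have e1 := comp k p hi hm hk
    rw [comp (κ (P.proj p)) p hi hm (hκ _)] at e1
    exact mul_right_cancel e1
  refine ⟨n, fun x hx y hy hxy => ?_, fun x hx => ?_, fun p hi hm => ?_⟩
  · have hs := Tiling.patch_eq_of_le (le_max_left s s') hxy
    have hs' := Tiling.patch_eq_of_le (le_max_right s s') hxy
    have hyk : y ∈ (R.chart (κ x)).baseSet :=
      R.isPE_baseSet (κ x) x (hκ x) y (Tiling.patch_eq_of_le h2 hs)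
    rw [key (κ x) y hy.1 hy.2 hyk, hn]
    simp only
    rw [hpe (κ x) x ⟨hx.1, hκ x⟩ y ⟨hy.1, hyk⟩ hs, hpe' (κ x) x ⟨hκ x, hx.2⟩ y ⟨hyk, hy.2⟩ hs']
  · filter_upwards [hflat (κ x) x ⟨hx.1, hκ x⟩, hflat' (κ x) x ⟨hκ x, hx.2⟩,
      (P.chart i).open_baseSet.mem_nhds hx.1, (Q.chart m).open_baseSet.mem_nhds hx.2,
      (R.chart (κ x)).open_baseSet.mem_nhds (hκ x)] with y e1 e2 hi hm hk
    rw [key (κ x) y hi hm hk, e1, e2]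
  · exact comp (κ (P.proj p)) p hi hm (hκ _)

instance setoid (T : Tiling d L) (G : Type u) [Group G] [TopologicalSpace G] :
    Setoid (FlatPEBundle T G) :=
  ⟨Equivalent, Equivalent.refl, Equivalent.symm, Equivalent.trans⟩

end FlatPEBundle

/-- The pattern equivariant representation variety of `T`: equivalence classes of flat pattern
equivariant principal `G`-bundles over `T`. -/
def PREP (T : Tiling d L) (G : Type u) [Group G] [TopologicalSpace G] : Type (u + 1) :=
  Quotient (FlatPEBundle.setoid T G)

/-- The class of a bundle in the representation variety. -/
def PREP.mk {T : Tiling d L} {G : Type u} [Group G] [TopologicalSpace G]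
    (P : FlatPEBundle T G) : PREP T G :=
  Quotient.mk (FlatPEBundle.setoid T G) P

section maps

variable {L' : Type*} {T : Tiling d L} {T' : Tiling d L'}

/-- Local map of tiling spaces: for every `s` there is an `r` such that the patch of radius `s` of
the image is determined by the patch of radius `r`. -/
def IsLocalMap (g : T.Hull → T'.Hull) : Prop :=
  ∀ s : ℝ, 0 < s → ∃ r : ℝ, 0 < r ∧ ∀ S₁ S₂ : T.Hull, S₁.1.patch r = S₂.1.patch r →
    (g S₁).1.patch s = (g S₂).1.patch s

/-- `g` is smooth along the translational leaves. -/
def IsLeafwiseSmooth (g : T.Hull → T'.Hull) : Prop :=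
  ∀ S : T.Hull, ∃ a : E d → E d, ContDiff ℝ ∞ a ∧
    ∀ (x : E d) (S₁ : T.Hull), S₁.1 = S.1.shift x → (g S₁).1 = (g S).1.shift (a x)

/-- `g` is a continuous local map such that `f S` and `g S` always lie in the same translational
leaf, with a gap smaller than `ε`. -/
structure IsLocalApprox (f : T.Hull → T'.Hull) (ε : ℝ) (g : T.Hull → T'.Hull) : Prop where
  continuous : Continuous g
  isLocal : IsLocalMap g
  gap : ∀ S : T.Hull, ∃ w : E d, ‖w‖ < ε ∧ (g S).1 = (f S).1.shift w

variable {G : Type u} [Group G] [TopologicalSpace G]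

/-- `P` is the pullback of `P'` along `a : ℝ^d → ℝ^d`, with the pulled back charts: there is a
continuous map of total spaces over `a`, the domains of the charts of `P` are the preimages of those
of `P'`, and the map is the identity of `G` in corresponding charts. -/
def IsPullbackAlong (a : E d → E d) (P' : FlatPEBundle T' G) (P : FlatPEBundle T G) : Prop :=
  ∃ (e : P.ι ≃ P'.ι) (F : P.Total → P'.Total), Continuous F ∧
    (∀ p, P'.proj (F p) = a (P.proj p)) ∧
    (∀ i, (P.chart i).baseSet = a ⁻¹' (P'.chart (e i)).baseSet) ∧
    ∀ i p, P.proj p ∈ (P.chart i).baseSet → (P'.chart (e i) (F p)).2 = (P.chart i p).2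

/-- `P` is a pullback of `P'` along the map `g : Ω_T → Ω_{T'}`.  A point `x` of `T` lies over the
points `y` of `T'` at which `T'` shows the pattern that `g (T - x)` has about the origin, up to the
radius of `P'`; the domains of the charts of `P` and the transition functions of `P` are those of
`P'`, pulled back by this correspondence.  (If `g (T - x) = T' - a x` for all `x`, then `y = a x` is
such a point and these are the preimages under `a` and the compositions with `a`.) -/
def IsPullback (g : T.Hull → T'.Hull) (P' : FlatPEBundle T' G) (P : FlatPEBundle T G) : Prop :=
  ∃ e : P.ι ≃ P'.ι,
    (∀ i, (P.chart i).baseSet = {x | ∃ y ∈ (P'.chart (e i)).baseSet,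
      (g (T.orbitPt x)).1.patch P'.radius = (T'.shift y).patch P'.radius}) ∧
    ∀ i j x y, y ∈ (P'.chart (e i)).baseSet → y ∈ (P'.chart (e j)).baseSet →
      (g (T.orbitPt x)).1.patch P'.radius = (T'.shift y).patch P'.radius →
      P.trans j i x = P'.trans (e j) (e i) y

end maps

end PETiling

open PETiling

/-! A flat PE bundle over `T` is the same thing as a flat Čech 1-cocycle on the tiling space: chart
domains and transition functions depend only on patches, so they extend from the orbit to the hull
(`FlatPEBundle.cech`). Finite local complexity makes the extended domains open and the extended
transition functions locally constant. Since the hull is compact, a locally constant gauge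
transformation on it is controlled by patches of one fixed radius, so equivalence of bundles is
cohomology of cocycles (`PREP.mk_eq_iff`).

Pulling a bundle back along a local map `g` is pulling its cocycle back along `g`
(`IsPullback.cohomologous`). The homeomorphism `f` need not be local, but cocycles pull back along
any continuous map. By rigidity of small translations the gap between `f` and `g` is a continuous
vector field, so moving along it is a homotopy from `f` to `g`. With discrete `G` a flat bundle is a
covering space, and homotopy lifting gives cohomologous pullbacks (`cohomologous_of_homotopy`,
`cohomologous_of_gap`). Hence every close local map induces the map of classes given by `f`, which
is inverted by `f.symm`.

Local approximations are needed to represent the pulled back classes by PE bundles.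
`exists_isLocalApprox` averages local translation vectors with a partition of unity made of local,
leafwise smooth functions; the nonlocal part of `f` is a small translation that the averaging
cancels. -/

namespace PETiling

universe u v

variable {d : ℕ} {L : Type v}

/-! ### Translations of tiles -/

theorem Tile.shift_zero (τ : Tile d L) : τ.shift 0 = τ := by
  ext1
  · simp [Tile.shift]
  · rfl

theorem Tile.shift_shift (τ : Tile d L) (x y : E d) : (τ.shift x).shift y = τ.shift (x + y) := by
  ext1
  · ext z
    simp [Tile.shift, add_assoc, add_comm y x]
  · rfl

theorem Tile.shift_injective (x : E d) : Function.Injective fun τ : Tile d L => τ.shift x := by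
  intro σ τ h
  have := congrArg (fun ρ : Tile d L => ρ.shift (-x)) h
  simpa [Tile.shift_shift, Tile.shift_zero] using this

theorem Tile.mem_shift_support {τ : Tile d L} {x y : E d} :
    y ∈ (τ.shift x).support ↔ y + x ∈ τ.support := Iff.rfl

/-- At a point of the compact support where the inner product with `x` is maximal, adding `x` cannot
increase it, so `‖x‖ ^ 2 ≤ 0`. -/
theorem Tile.eq_zero_of_shift_eq {τ : Tile d L} {x : E d} (h : τ.shift x = τ) : x = 0 := by
  obtain ⟨z, hz, hmax⟩ := τ.isCompact.exists_isMaxOn τ.nonempty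
    (f := fun y : E d => inner ℝ x y) (by fun_prop)
  have h1 : z ∈ (τ.shift x).support := by rw [h]; exact hz
  have h2 := hmax (Tile.mem_shift_support.1 h1)
  simp only [mem_ofPred_eq, inner_add_right, real_inner_self_eq_norm_sq] at h2
  have : ‖x‖ ^ 2 ≤ 0 := by linarith
  simpa using (pow_eq_zero_iff two_ne_zero).1 (le_antisymm this (sq_nonneg _))

theorem Tile.shift_left_injective (τ : Tile d L) : Function.Injective τ.shift := by
  intro x y h
  have h1 : (τ.shift x).shift (-y) = τ := by
    rw [h, Tile.shift_shift, add_neg_cancel, Tile.shift_zero]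
  rw [Tile.shift_shift] at h1
  exact add_neg_eq_zero.1 (Tile.eq_zero_of_shift_eq h1)

/-! ### Patches, the tiling topology and the hull -/

namespace Tiling

theorem mem_shift_tiles {S : Tiling d L} {x : E d} {τ : Tile d L} :
    τ ∈ (S.shift x).tiles ↔ τ.shift (-x) ∈ S.tiles := by
  constructor
  · rintro ⟨σ, hσ, rfl⟩
    simpa [Tile.shift_shift, Tile.shift_zero] using hσ
  · intro h
    exact ⟨_, h, by simp [Tile.shift_shift, Tile.shift_zero]⟩

theorem shift_zero (S : Tiling d L) : S.shift 0 = S := by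
  ext τ
  simp [mem_shift_tiles, Tile.shift_zero]

theorem shift_shift (S : Tiling d L) (x y : E d) : (S.shift x).shift y = S.shift (x + y) := by
  ext τ
  simp [mem_shift_tiles, Tile.shift_shift]

theorem patch_shift_congr {S S' : Tiling d L} {r s : ℝ} {w : E d} (h : S.patch r = S'.patch r)
    (hs : s + ‖w‖ ≤ r) : (S.shift w).patch s = (S'.shift w).patch s := by
  have key : ∀ A B : Tiling d L, A.patch r = B.patch r →
      (A.shift w).patch s ⊆ (B.shift w).patch s := by
    rintro A B hAB _ ⟨⟨σ, hσ, rfl⟩, y, hy, hyr⟩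
    have h1 : σ ∈ A.patch r := by
      refine ⟨hσ, y + w, hy, ?_⟩
      rw [mem_ball_zero_iff] at hyr ⊢
      linarith [norm_add_le y w]
    rw [hAB] at h1
    exact ⟨⟨σ, h1.1, rfl⟩, y, hy, hyr⟩
  exact Subset.antisymm (key S S' h) (key S' S h.symm)

theorem patch_finite (S : Tiling d L) (r : ℝ) : (S.patch r).Finite := S.locallyFinite r

theorem patch_nonempty (S : Tiling d L) {r : ℝ} (hr : 0 < r) : (S.patch r).Nonempty := by
  obtain ⟨τ, hτ, h0⟩ := S.covers 0
  exact ⟨τ, hτ, 0, h0, by simpa using hr⟩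

theorem exists_mem_patch {S : Tiling d L} {τ : Tile d L} (h : τ ∈ S.tiles) :
    ∃ r > 0, τ ∈ S.patch r := by
  obtain ⟨y, hy⟩ := τ.nonempty
  exact ⟨‖y‖ + 1, by positivity, h, y, hy, by simp⟩

theorem eq_of_patch_eq {S S' : Tiling d L} (h : ∀ r > 0, S.patch r = S'.patch r) : S = S' := by
  ext τ
  constructor
  · intro hτ
    obtain ⟨r, hr, h1⟩ := exists_mem_patch hτ
    rw [h r hr] at h1
    exact h1.1
  · intro hτ
    obtain ⟨r, hr, h1⟩ := exists_mem_patch hτ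
    rw [← h r hr] at h1
    exact h1.1

/-- The tilings that agree with `S` up to radius `s` after a translation by less than `η`. -/
def box (s η : ℝ) (S : Tiling d L) : Set (Tiling d L) :=
  {S' | ∃ w : E d, ‖w‖ < η ∧ (S'.shift w).patch s = S.patch s}

theorem box_mono {s s' η η' : ℝ} (hs : s ≤ s') (hη : η' ≤ η) (S : Tiling d L) :
    box s' η' S ⊆ box s η S := fun _ ⟨w, hw, h⟩ => ⟨w, hw.trans_le hη, patch_eq_of_le hs h⟩

theorem self_mem_box {s η : ℝ} (hη : 0 < η) (S : Tiling d L) : S ∈ box s η S :=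
  ⟨0, by simpa using hη, by rw [shift_zero]⟩

theorem isOpen_box (s η : ℝ) (S : Tiling d L) : IsOpen (box s η S) := by
  rintro S₁ ⟨w, hw, h⟩
  -- The first entry leaves room for `‖w' + w‖ < η`; the second makes `1 / ε` exceed `s + ‖w‖`, with
  -- `|s|` because `s` may be negative.
  set ε : ℝ := min ((η - ‖w‖)) (1 / (|s| + ‖w‖ + 1)) with hε
  have h0 : 0 < ε := lt_min (by linarith) (by positivity)
  refine ⟨ε, h0, ?_⟩
  rintro S₂ ⟨w', hw', h'⟩
  have h1 : |s| + ‖w‖ + 1 ≤ 1 / ε := by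
    rw [le_one_div (by positivity) h0]
    exact min_le_right _ _
  refine ⟨w' + w, ?_, ?_⟩
  · have := min_le_left (η - ‖w‖) (1 / (|s| + ‖w‖ + 1))
    linarith [norm_add_le w' w]
  · rw [← shift_shift, ← h]
    exact patch_shift_congr h' (by linarith [le_abs_self s])

theorem box_mem_nhds {s η : ℝ} (hη : 0 < η) (S : Tiling d L) : box s η S ∈ 𝓝 S :=
  (isOpen_box s η S).mem_nhds (self_mem_box hη S)

theorem exists_box_subset {S : Tiling d L} {U : Set (Tiling d L)} (hU : U ∈ 𝓝 S) :
    ∃ s > 0, ∃ η > 0, box s η S ⊆ U := by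
  obtain ⟨V, hVU, hV, hS⟩ := mem_nhds_iff.1 hU
  obtain ⟨ε, hε, h⟩ := hV S hS
  exact ⟨1 / ε, by positivity, ε, hε, fun S' hS' => hVU (h S' hS')⟩

theorem tendsto_nhds_iff {α : Type*} {l : Filter α} {φ : α → Tiling d L} {S : Tiling d L} :
    Filter.Tendsto φ l (𝓝 S) ↔ ∀ s > 0, ∀ η > 0, ∀ᶠ a in l, φ a ∈ box s η S := by
  constructor
  · intro h s _ η hη
    exact h (box_mem_nhds hη S)
  · intro h U hU
    obtain ⟨s, hs, η, hη, hsub⟩ := exists_box_subset hU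
    exact Filter.mem_of_superset (h s hs η hη) fun a ha => hsub ha

theorem continuous_shift : Continuous fun p : Tiling d L × E d => p.1.shift p.2 := by
  rw [continuous_iff_continuousAt]
  rintro ⟨S, x⟩
  refine tendsto_nhds_iff.2 fun s hs η hη => ?_
  have h1 : ∀ᶠ p : Tiling d L × E d in 𝓝 (S, x), p.1 ∈ box (s + ‖x‖) (η / 2) S :=
    continuous_fst.continuousAt (box_mem_nhds (half_pos hη) S)
  have h2 : ∀ᶠ p : Tiling d L × E d in 𝓝 (S, x), p.2 ∈ Metric.ball x (η / 2) :=
    continuous_snd.continuousAt (Metric.ball_mem_nhds x (half_pos hη))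
  filter_upwards [h1, h2] with ⟨S', x'⟩ ⟨w, hw, h⟩ hx
  -- Moving by `x'` and then by this vector is moving by `w` and then by `x`, which is where the
  -- closeness of `S'` to `S` is known.
  refine ⟨w + x - x', ?_, ?_⟩
  · rw [Metric.mem_ball, dist_eq_norm] at hx
    have : ‖w + x - x'‖ ≤ ‖w‖ + ‖x' - x‖ := by
      rw [add_sub_assoc, ← norm_neg (x' - x), neg_sub]
      exact norm_add_le _ _
    simp only at hx
    linarith
  · simp only
    rw [shift_shift, show x' + (w + x - x') = w + x by abel, ← shift_shift]
    exact patch_shift_congr h le_rfl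

variable {T : Tiling d L}

/-- A box around `S` meets the orbit, and the leftover small translation is absorbed into the orbit
point, so the match of patches is exact. Patch-determined facts thereby pass between `T` and its
hull. -/
theorem exists_patch_eq_of_mem_hull {S : Tiling d L} (hS : S ∈ T.Hull) (r : ℝ) :
    ∃ x, S.patch r = (T.shift x).patch r := by
  obtain ⟨_, ⟨w, -, h⟩, ⟨x, rfl⟩⟩ := mem_closure_iff_nhds.1 hS _ (box_mem_nhds (s := r) one_pos S)
  exact ⟨x + w, by rw [← h, shift_shift]⟩

theorem shift_mem_hull {S : Tiling d L} (hS : S ∈ T.Hull) (x : E d) : S.shift x ∈ T.Hull := by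
  have hc : Continuous fun S : Tiling d L => S.shift x :=
    continuous_shift.comp (continuous_id.prodMk continuous_const)
  refine map_mem_closure (f := fun S : Tiling d L => S.shift x) hc hS ?_
  rintro _ ⟨y, rfl⟩
  exact ⟨y + x, (shift_shift T y x).symm⟩

/-- Translation on the hull. -/
def hullShift (S : T.Hull) (x : E d) : T.Hull := ⟨S.1.shift x, shift_mem_hull S.2 x⟩

theorem continuous_hullShift : Continuous fun p : T.Hull × E d => hullShift p.1 p.2 :=
  Continuous.subtype_mk (continuous_shift.comp
    ((continuous_subtype_val.comp continuous_fst).prodMk continuous_snd)) _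

theorem hullShift_zero (S : T.Hull) : hullShift S 0 = S := Subtype.ext (shift_zero _)

theorem continuous_orbitPt (T : Tiling d L) : Continuous T.orbitPt :=
  Continuous.subtype_mk (continuous_shift.comp (continuous_const.prodMk continuous_id)) _

theorem box_mem_nhds_hull {s η : ℝ} (hη : 0 < η) (S : T.Hull) :
    ∀ᶠ S' in 𝓝 S, S'.1 ∈ box s η S.1 :=
  continuous_subtype_val.continuousAt (box_mem_nhds hη S.1)

theorem exists_box_subset_hull {S : T.Hull} {U : Set T.Hull} (hU : U ∈ 𝓝 S) :
    ∃ s > 0, ∃ η > 0, ∀ S' : T.Hull, S'.1 ∈ box s η S.1 → S' ∈ U := by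
  rw [nhds_subtype_eq_comap, Filter.mem_comap] at hU
  obtain ⟨V, hV, hVU⟩ := hU
  obtain ⟨s, hs, η, hη, h⟩ := exists_box_subset hV
  exact ⟨s, hs, η, hη, fun S' hS' => hVU (h hS')⟩

/-! ### Consequences of finite local complexity -/

namespace FLC

/-- A finite set of tiles representing, up to translation, the tiles near every point of the
tilings in the hull. -/
theorem exists_finite_tiles (hT : T.FLC) : ∃ Q : Set (Tile d L), Q.Finite ∧
    ∀ S ∈ T.Hull, ∀ τ ∈ S.patch 1, ∃ σ ∈ Q, ∃ w, τ = σ.shift w := by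
  obtain ⟨F, hF, h⟩ := hT 1 one_pos
  -- The family `F` may contain infinite sets that represent no patch; only its finite members are
  -- relevant.
  refine ⟨⋃ q ∈ {q ∈ F | q.Finite}, q,
    (hF.subset (sep_subset _ _)).biUnion fun q hq => hq.2, fun S hS τ hτ => ?_⟩
  obtain ⟨x, hx⟩ := exists_patch_eq_of_mem_hull hS 1
  obtain ⟨q, hq, w, hw⟩ := h x
  rw [hx, hw] at hτ
  obtain ⟨σ, hσ, rfl⟩ := hτ
  refine ⟨σ, mem_biUnion (⟨hq, ?_⟩ : q ∈ {q ∈ F | q.Finite}) hσ, w, rfl⟩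
  refine Finite.of_finite_image ?_ (Tile.shift_injective w).injOn
  rw [← hw]
  exact patch_finite _ _

/-- Finitely many patches of a given radius extend a given tile. -/
theorem finite_patches (hT : T.FLC) {R : ℝ} (hR : 0 < R) (τ : Tile d L) :
    {p | ∃ S ∈ T.Hull, τ ∈ S.patch R ∧ S.patch R = p}.Finite := by
  obtain ⟨F, hF, h⟩ := hT R hR
  have hfin : (⋃ q ∈ {q ∈ F | q.Finite}, ⋃ σ ∈ q,
      {p : Set (Tile d L) | ∃ w, σ.shift w = τ ∧ p = (fun ρ => ρ.shift w) '' q}).Finite := by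
    refine (hF.subset (sep_subset _ _)).biUnion fun q hq => hq.2.biUnion fun σ _ => ?_
    -- A tile has no nonzero period, so carrying `σ` to `τ` fixes the translation and hence the
    -- patch.
    refine Set.Subsingleton.finite ?_
    rintro p ⟨w, hw, rfl⟩ p' ⟨w', hw', rfl⟩
    rw [σ.shift_left_injective (hw.trans hw'.symm)]
  refine hfin.subset ?_
  rintro _ ⟨S, hS, hτ, rfl⟩
  obtain ⟨x, hx⟩ := exists_patch_eq_of_mem_hull hS R
  obtain ⟨q, hq, w, hw⟩ := h x
  rw [hx, hw] at hτ
  obtain ⟨σ, hσ, rfl⟩ := hτ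
  have hqf : q.Finite := by
    refine Finite.of_finite_image ?_ (Tile.shift_injective w).injOn
    rw [← hw]
    exact patch_finite _ _
  exact mem_biUnion (⟨hq, hqf⟩ : q ∈ {q ∈ F | q.Finite})
    (mem_biUnion hσ ⟨w, rfl, hx.trans hw⟩)

/-- Two small translates of a tiling in the hull that share a tile coincide. -/
theorem rigid (hT : T.FLC) : ∃ ρ > 0, ∀ S ∈ T.Hull, ∀ s > 0, ∀ u v : E d,
    (S.shift u).patch s = (S.shift v).patch s → ‖u - v‖ < ρ → u = v := by
  obtain ⟨Q, hQ, hcov⟩ := hT.exists_finite_tiles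
  -- Finitely many tile shapes have a common lower bound `ρ` for their inradii. Two translates of
  -- one tile by less than `ρ` then overlap in their interiors, so in a tiling they must coincide.
  have hball : ∀ᶠ ρ in 𝓝[>] (0 : ℝ), ∀ σ ∈ Q, ∃ c, Metric.ball c ρ ⊆ interior σ.support := by
    rw [Filter.eventually_all_finite hQ]
    intro σ _
    have hne : (interior σ.support).Nonempty := by
      rw [← closure_nonempty_iff, σ.regular]
      exact σ.nonempty
    obtain ⟨c, hc⟩ := hne
    obtain ⟨δ, hδ, hb⟩ := Metric.isOpen_iff.1 isOpen_interior c hc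
    filter_upwards [Ioc_mem_nhdsGT hδ] with ρ hρ
    exact ⟨c, (Metric.ball_subset_ball hρ.2).trans hb⟩
  obtain ⟨ρ, hb, hρ⟩ := (hball.and self_mem_nhdsWithin).exists
  refine ⟨ρ, hρ, fun S hS s hs u v huv hlt => ?_⟩
  obtain ⟨τ, hτ⟩ := (S.shift u).patch_nonempty hs
  have hτ' := hτ
  rw [huv] at hτ'
  have h1 := mem_shift_tiles.1 hτ.1
  have h2 := mem_shift_tiles.1 hτ'.1
  by_contra hne
  have hne' : τ.shift (-u) ≠ τ.shift (-v) := fun h =>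
    hne (neg_injective (τ.shift_left_injective h))
  obtain ⟨c, hc⟩ : ∃ c, Metric.ball c ρ ⊆ interior τ.support := by
    obtain ⟨y, hy⟩ := τ.nonempty
    -- The list `Q` only knows tiles near the origin, so `τ` is first recentred at one of its
    -- points.
    obtain ⟨σ, hσ, w, hw⟩ := hcov ((S.shift u).shift y) (shift_mem_hull (shift_mem_hull hS u) y)
      (τ.shift y) ⟨⟨τ, hτ.1, rfl⟩, 0, by simpa [Tile.mem_shift_support] using hy, by simp⟩
    obtain ⟨c, hc⟩ := hb σ hσ
    have hτσ : τ = σ.shift (w - y) := by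
      rw [sub_eq_add_neg, ← Tile.shift_shift, ← hw, Tile.shift_shift, add_neg_cancel,
        Tile.shift_zero]
    refine ⟨c - (w - y), fun z hz => ?_⟩
    rw [hτσ, Tile.shift]
    simp only [preimage_add_interior]
    refine hc ?_
    rw [Metric.mem_ball, dist_eq_norm] at hz ⊢
    rwa [show z + (w - y) - c = z - (c - (w - y)) by abel]
  have hd := S.disjoint _ h1 _ h2 hne'
  simp only [Tile.shift, preimage_add_interior] at hd
  refine Set.disjoint_left.1 hd (show c + u ∈ _ from ?_) ?_
  · exact hc (by simp [hρ])
  · refine hc ?_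
    rw [Metric.mem_ball, dist_eq_norm]
    rwa [show c + u + -v - c = u - v by abel]

/-- The part of the hull cut out by an open pattern equivariant set is open. -/
theorem isOpen_cylinder (hT : T.FLC) {t : ℝ} (ht : 0 < t) {O : Set (E d)} (hO : IsOpen O)
    (hPE : T.IsPESet t O) :
    IsOpen {S : T.Hull | ∃ x ∈ O, S.1.patch t = (T.shift x).patch t} := by
  rw [isOpen_iff_mem_nhds]
  rintro S ⟨x, hx, hSx⟩
  obtain ⟨τ, hτ⟩ := S.1.patch_nonempty ht
  -- One neighbourhood must serve the possibly infinitely many `x'` that show the patch of `S`. By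
  -- pattern equivariance it depends only on the patch of radius `t + 1` at `x'`, and there are
  -- finitely many of these because all contain `τ`. The extra `1` pays for moving by `‖v‖ < 1`.
  have huni : ∀ᶠ v in 𝓝 (0 : E d), ∀ x', (T.shift x').patch t = S.1.patch t → x' - v ∈ O := by
    have hfin := hT.finite_patches (R := t + 1) (by linarith) τ
    have : ∀ᶠ v in 𝓝 (0 : E d),
        ∀ p ∈ {p | ∃ S ∈ T.Hull, τ ∈ S.patch (t + 1) ∧ S.patch (t + 1) = p},
        ∀ x', (T.shift x').patch t = S.1.patch t → (T.shift x').patch (t + 1) = p →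
          x' - v ∈ O := by
      rw [Filter.eventually_all_finite hfin]
      intro p _
      by_cases hp : ∃ x', (T.shift x').patch t = S.1.patch t ∧ (T.shift x').patch (t + 1) = p
      · obtain ⟨x₁, h1, h2⟩ := hp
        have hx₁ : x₁ ∈ O := hPE x hx x₁ (hSx.symm.trans h1.symm)
        have hc : Filter.Tendsto (fun v : E d => x₁ - v) (𝓝 0) (𝓝 (x₁ - 0)) :=
          (continuous_const.sub continuous_id).continuousAt
        rw [sub_zero] at hc
        filter_upwards [hc (hO.mem_nhds hx₁), Metric.ball_mem_nhds (0 : E d) one_pos] with v hv hv1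
        intro x' _ h4
        refine hPE (x₁ - v) hv _ ?_
        rw [sub_eq_add_neg, sub_eq_add_neg, ← shift_shift, ← shift_shift]
        refine patch_shift_congr (h2.trans h4.symm) ?_
        rw [norm_neg]
        rw [mem_ball_zero_iff] at hv1
        linarith
      · push Not at hp
        filter_upwards with v x' h3 h4
        exact absurd h4 (hp x' h3)
    filter_upwards [this] with v hv x' hx'
    refine hv _ ⟨T.shift x', (T.orbitPt x').2, ?_, rfl⟩ x' hx' rfl
    rw [← hx'] at hτ
    exact ⟨hτ.1, hτ.2.mono (inter_subset_inter_right _ (Metric.ball_subset_ball (by linarith)))⟩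
  obtain ⟨δ, hδ, hball⟩ := Metric.mem_nhds_iff.1 huni
  filter_upwards [box_mem_nhds_hull (s := t) hδ S] with S' ⟨w, hw, hS'⟩
  obtain ⟨z, hz⟩ := exists_patch_eq_of_mem_hull S'.2 (t + ‖w‖)
  have h1 : (T.shift (z + w)).patch t = S.1.patch t := by
    rw [← hS', ← shift_shift]
    exact patch_shift_congr hz.symm le_rfl
  refine ⟨z, ?_, patch_eq_of_le (by linarith [norm_nonneg w]) hz⟩
  have := hball (show w ∈ Metric.ball 0 δ by simpa using hw) (z + w) h1
  simpa using this

end FLC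

/-! ### Compactness of the hull -/

theorem exists_limit_tiling (𝒰 : Ultrafilter (Tiling d L))
    (h : ∀ R : ℝ, ∃ S₀ : Tiling d L, ∀ᶠ S in (𝒰 : Filter (Tiling d L)), S.patch R = S₀.patch R) :
    ∃ S₀ : Tiling d L, S₀.tiles = {τ | ∀ᶠ S in (𝒰 : Filter (Tiling d L)), τ ∈ S.tiles} ∧
      (𝒰 : Filter (Tiling d L)) ≤ 𝓝 S₀ := by
  choose A hA using h
  have key : ∀ R τ, (τ.support ∩ Metric.ball 0 R).Nonempty →
      ((∀ᶠ S in (𝒰 : Filter (Tiling d L)), τ ∈ S.tiles) ↔ τ ∈ (A R).tiles) := by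
    intro R τ hne
    constructor
    · intro h1
      obtain ⟨S, hS, h2⟩ := (h1.and (hA R)).exists
      have : τ ∈ S.patch R := ⟨hS, hne⟩
      rw [h2] at this
      exact this.1
    · intro h1
      filter_upwards [hA R] with S hS
      have : τ ∈ (A R).patch R := ⟨h1, hne⟩
      rw [← hS] at this
      exact this.1
  let S₀ : Tiling d L :=
    { tiles := {τ | ∀ᶠ S in (𝒰 : Filter (Tiling d L)), τ ∈ S.tiles}
      covers := fun y => by
        obtain ⟨τ, hτ, hy⟩ := (A (‖y‖ + 1)).covers y
        exact ⟨τ, (key _ τ ⟨y, hy, by simp⟩).2 hτ, hy⟩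
      disjoint := fun σ hσ τ hτ hne => by
        obtain ⟨S, h1, h2⟩ := (Filter.Eventually.and hσ hτ).exists
        exact S.disjoint σ h1 τ h2 hne
      locallyFinite := fun r => ((A r).locallyFinite r).subset fun τ hτ =>
        by
        obtain ⟨h1, h2⟩ := hτ
        exact ⟨(key r τ h2).1 h1, h2⟩ }
  refine ⟨S₀, rfl, ?_⟩
  have hp : ∀ R, S₀.patch R = (A R).patch R := fun R => by
    ext τ
    exact ⟨fun hτ => ⟨(key R τ hτ.2).1 hτ.1, hτ.2⟩, fun hτ => ⟨(key R τ hτ.2).2 hτ.1, hτ.2⟩⟩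
  refine tendsto_nhds_iff (φ := id).2 fun s _ η hη => ?_
  filter_upwards [hA s] with S hS
  exact ⟨0, by simpa using hη, by rw [id, shift_zero, hS, hp]⟩

/-- A fixed tile removes the freedom of translation, so only finitely many patches of each radius
remain and an ultrafilter selects one of them. The selected patches assemble to a limit tiling. -/
theorem FLC.isCompact_tile_mem (hT : T.FLC) (τ : Tile d L) :
    IsCompact {S | S ∈ T.Hull ∧ τ ∈ S.tiles} := by
  rw [isCompact_iff_ultrafilter_le_nhds]
  intro 𝒰 h𝒰
  rw [Filter.le_principal_iff] at h𝒰
  obtain ⟨y, hy⟩ := τ.nonempty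
  have hloc : ∀ R : ℝ, ∃ S₀ : Tiling d L,
      ∀ᶠ S in (𝒰 : Filter (Tiling d L)), S.patch R = S₀.patch R := by
    intro R
    -- Large enough that `τ` itself belongs to the patch.
    set R' := max R (‖y‖ + 1)
    have hpos : 0 < R' := lt_of_lt_of_le (by positivity) (le_max_right _ _)
    have hfin := hT.finite_patches hpos τ
    have hev : ∀ᶠ S in (𝒰 : Filter (Tiling d L)),
        ∃ p ∈ {p | ∃ S ∈ T.Hull, τ ∈ S.patch R' ∧ S.patch R' = p}, S.patch R' = p := by
      filter_upwards [h𝒰] with S hS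
      refine ⟨S.patch R', ⟨S, hS.1, ⟨hS.2, y, hy, ?_⟩, rfl⟩, rfl⟩
      rw [mem_ball_zero_iff]
      exact lt_of_lt_of_le (by linarith) (le_max_right _ _)
    obtain ⟨p, ⟨S₁, -, -, rfl⟩, h2⟩ := (Ultrafilter.eventually_exists_mem_iff hfin).1 hev
    exact ⟨S₁, h2.mono fun S hS => patch_eq_of_le (le_max_left _ _) hS⟩
  obtain ⟨S₀, h1, h2⟩ := exists_limit_tiling 𝒰 hloc
  refine ⟨S₀, ⟨?_, ?_⟩, h2⟩
  · exact isClosed_closure.mem_of_tendsto (f := id) h2 (by filter_upwards [h𝒰] with S hS using hS.1)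
  · rw [h1]
    filter_upwards [h𝒰] with S hS using hS.2

/-- A bounded translation makes any tiling of the hull contain one of finitely many reference tiles.
The hull is therefore covered by finitely many continuous images of compact products. -/
theorem FLC.isCompact_hull (hT : T.FLC) : IsCompact T.Hull := by
  obtain ⟨Q, hQ, hcov⟩ := hT.exists_finite_tiles
  have hb : ∀ σ : Tile d L, ∃ b : ℝ, ∀ y ∈ σ.support, ‖y‖ ≤ b := fun σ =>
    σ.isCompact.isBounded.exists_norm_le
  choose b hb using hb
  have hK : IsCompact (⋃ σ ∈ Q, (fun p : Tiling d L × E d => p.1.shift p.2) ''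
      ({S | S ∈ T.Hull ∧ σ ∈ S.tiles} ×ˢ Metric.closedBall 0 (b σ + 1))) :=
    hQ.isCompact_biUnion fun σ _ =>
      ((hT.isCompact_tile_mem σ).prod (isCompact_closedBall _ _)).image continuous_shift
  refine hK.of_isClosed_subset isClosed_closure fun S hS => ?_
  obtain ⟨τ, hτ⟩ := S.patch_nonempty one_pos
  obtain ⟨σ, hσ, w, rfl⟩ := hcov S hS τ hτ
  refine mem_biUnion hσ ⟨(S.shift (-w), w), ⟨⟨shift_mem_hull hS _, ?_⟩, ?_⟩, ?_⟩
  · rw [mem_shift_tiles, neg_neg]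
    exact hτ.1
  · obtain ⟨y, hy, hy1⟩ := hτ.2
    rw [mem_ball_zero_iff] at hy1
    have := hb σ (y + w) hy
    rw [mem_closedBall_zero_iff]
    have h3 := norm_sub_le (y + w) y
    rw [add_sub_cancel_left] at h3
    linarith
  · simp [shift_shift, shift_zero]

theorem FLC.compactSpace_hull (hT : T.FLC) : CompactSpace T.Hull :=
  isCompact_iff_compactSpace.1 hT.isCompact_hull

/-- Tilings in the hull that agree up to a large radius lie in a common member of a given cover. -/
theorem FLC.exists_lebesgue_radius (hT : T.FLC) (U : T.Hull → Set T.Hull) (hU : ∀ S, U S ∈ 𝓝 S) :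
    ∃ s > 0, ∀ S : T.Hull, ∃ S₀, ∀ S' : T.Hull, S'.1.patch s = S.1.patch s → S' ∈ U S₀ := by
  have := hT.compactSpace_hull
  choose s hs η hη hbox using fun S => exists_box_subset_hull (hU S)
  obtain ⟨t, ht⟩ := isCompact_univ.elim_nhds_subcover
    (fun S : T.Hull => {S' | S'.1 ∈ box (s S) (η S) S.1}) fun S _ => box_mem_nhds_hull (hη S) S
  -- Radius `s + η` ensures that agreement survives, up to radius `s`, a translation of length below
  -- `η`.
  obtain ⟨M, hM⟩ := (t.image fun S => s S + η S).exists_le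
  refine ⟨max M 1, by positivity, fun S => ?_⟩
  have hS : S ∈ ⋃ x ∈ t, {S' : T.Hull | S'.1 ∈ box (s x) (η x) x.1} :=
    ht.2 (mem_univ S)
  obtain ⟨S₀, hS₀, w, hw, h⟩ := mem_iUnion₂.1 hS
  refine ⟨S₀, fun S' hS' => hbox S₀ S' ⟨w, hw, ?_⟩⟩
  rw [← h]
  refine patch_shift_congr hS' ?_
  have := hM _ (Finset.mem_image_of_mem _ hS₀)
  linarith [le_max_left M 1]

end Tiling

/-! ### Flat cocycles and homotopy invariance -/

/-- A Čech cocycle on `X` with locally constant values in `G`. -/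
structure FlatCocycle (X : Type v) [TopologicalSpace X] (G : Type u) [Group G] where
  ι : Type
  dom : ι → Set X
  isOpen_dom : ∀ i, IsOpen (dom i)
  covers : ∀ x, ∃ i, x ∈ dom i
  trans : ι → ι → X → G
  trans_mul : ∀ i j k x, x ∈ dom i → x ∈ dom j → x ∈ dom k →
    trans k j x * trans j i x = trans k i x
  flat : ∀ i j x, x ∈ dom i → x ∈ dom j → ∀ᶠ y in 𝓝 x, trans j i y = trans j i x

namespace FlatCocycle

variable {X Y : Type*} [TopologicalSpace X] [TopologicalSpace Y]
  {G : Type u} [Group G]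

theorem trans_self (C : FlatCocycle X G) {i : C.ι} {x : X} (hx : x ∈ C.dom i) :
    C.trans i i x = 1 := by
  simpa using C.trans_mul i i i x hx hx hx

/-- Two flat cocycles are cohomologous if they define isomorphic flat bundles. -/
def Cohomologous (C D : FlatCocycle X G) : Prop :=
  ∃ l : D.ι → C.ι → X → G,
    (∀ k i x, x ∈ C.dom i → x ∈ D.dom k → ∀ᶠ y in 𝓝 x, l k i y = l k i x) ∧
    (∀ i j k x, x ∈ C.dom i → x ∈ C.dom j → x ∈ D.dom k → l k j x * C.trans j i x = l k i x) ∧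
    ∀ i k m x, x ∈ C.dom i → x ∈ D.dom k → x ∈ D.dom m → D.trans m k x * l k i x = l m i x

namespace Cohomologous

variable {C D F : FlatCocycle X G}

/-- A cohomology between cocycles that agree up to a renaming of the charts. -/
theorem of_equiv (e : C.ι ≃ D.ι) (hdom : ∀ i, C.dom i = D.dom (e i))
    (htrans : ∀ i j x, x ∈ C.dom i → x ∈ C.dom j → C.trans j i x = D.trans (e j) (e i) x) :
    Cohomologous C D := by
  refine ⟨fun k i => D.trans k (e i), fun k i x hi hk => D.flat _ _ x (hdom i ▸ hi) hk,
    fun i j k x hi hj hk => ?_, fun i k m x hi hk hm => ?_⟩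
  · rw [htrans i j x hi hj]
    exact D.trans_mul _ _ _ x (hdom i ▸ hi) (hdom j ▸ hj) hk
  · exact D.trans_mul _ _ _ x (hdom i ▸ hi) hk hm

theorem symm (h : Cohomologous C D) : Cohomologous D C := by
  obtain ⟨l, hflat, h1, h2⟩ := h
  refine ⟨fun i k x => (l k i x)⁻¹, fun i k x hk hi => ?_, fun k m i x hk hm hi => ?_,
    fun k i j x hk hi hj => ?_⟩
  · filter_upwards [hflat k i x hi hk] with y hy
    rw [hy]
  · simp only
    rw [← h2 i k m x hi hk hm, mul_inv_rev, inv_mul_cancel_right]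
  · simp only
    rw [← h1 i j k x hi hj hk, mul_inv_rev, mul_inv_cancel_left]

/-- The composite passes through a chosen chart `κ x` of `D`. The value does not depend on the chart
(`key`), so near `x` the chart can be held fixed and local constancy follows. -/
theorem trans (h : Cohomologous C D) (h' : Cohomologous D F) : Cohomologous C F := by
  obtain ⟨l, hflat, h1, h2⟩ := h
  obtain ⟨l', hflat', h1', h2'⟩ := h'
  choose κ hκ using D.covers
  have key : ∀ i k m x, x ∈ C.dom i → x ∈ D.dom k → x ∈ F.dom m →
      l' m (κ x) x * l (κ x) i x = l' m k x * l k i x := by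
    intro i k m x hi hk hm
    rw [← h2 i (κ x) k x hi (hκ x) hk, ← mul_assoc, h1' (κ x) k m x (hκ x) hk hm]
  refine ⟨fun m i x => l' m (κ x) x * l (κ x) i x, fun m i x hi hm => ?_,
    fun i j m x hi hj hm => ?_, fun i m n x hi hm hn => ?_⟩
  · filter_upwards [hflat (κ x) i x hi (hκ x), hflat' m (κ x) x (hκ x) hm,
      (C.isOpen_dom i).mem_nhds hi, (F.isOpen_dom m).mem_nhds hm,
      (D.isOpen_dom (κ x)).mem_nhds (hκ x)] with y e1 e2 hi' hm' hk'
    rw [key i (κ x) m y hi' hk' hm', e1, e2]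
  · simp only
    rw [mul_assoc, h1 i j _ x hi hj (hκ x)]
  · simp only
    rw [← mul_assoc, h2' _ m n x (hκ x) hm hn]

end Cohomologous

/-- The pullback of a flat cocycle along a continuous map. -/
def pullback (C : FlatCocycle Y G) (φ : C(X, Y)) : FlatCocycle X G where
  ι := C.ι
  dom i := φ ⁻¹' C.dom i
  isOpen_dom i := (C.isOpen_dom i).preimage φ.continuous
  covers x := C.covers (φ x)
  trans j i x := C.trans j i (φ x)
  trans_mul i j k x := C.trans_mul i j k (φ x)
  flat i j x hi hj := φ.continuous.continuousAt.eventually (C.flat i j (φ x) hi hj)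

theorem Cohomologous.pullback {C D : FlatCocycle Y G} (h : Cohomologous C D) (φ : C(X, Y)) :
    Cohomologous (C.pullback φ) (D.pullback φ) := by
  obtain ⟨l, hflat, h1, h2⟩ := h
  exact ⟨fun k i x => l k i (φ x),
    fun k i x hi hk => φ.continuous.continuousAt.eventually (hflat k i (φ x) hi hk),
    fun i j k x => h1 i j k (φ x), fun i k m x => h2 i k m (φ x)⟩

theorem cohomologous_pullback_pullback {X Y : Type*} [TopologicalSpace X]
    [TopologicalSpace Y] (C : FlatCocycle X G) (φ : C(Y, X)) (ψ : C(X, Y))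
    (h : ∀ x, φ (ψ x) = x) : Cohomologous ((C.pullback φ).pullback ψ) C := by
  refine Cohomologous.of_equiv (C := (C.pullback φ).pullback ψ) (D := C) (Equiv.refl C.ι)
    (fun i => ?_) fun i j x _ _ => ?_
  · ext x
    change φ (ψ x) ∈ C.dom i ↔ x ∈ C.dom i
    rw [h]
  · change C.trans j i (φ (ψ x)) = C.trans j i x
    rw [h]

section core

variable [TopologicalSpace G] [ContinuousMul G]

/-- The bundle glued from a flat cocycle by left multiplication. -/
noncomputable def core (C : FlatCocycle X G) : FiberBundleCore C.ι X G where
  baseSet := C.dom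
  isOpen_baseSet := C.isOpen_dom
  indexAt x := (C.covers x).choose
  mem_baseSet_at x := (C.covers x).choose_spec
  coordChange i j x a := C.trans j i x * a
  coordChange_self i x hx a := by rw [C.trans_self hx, one_mul]
  continuousOn_coordChange i j := by
    rintro ⟨x, a⟩ ⟨hx, -⟩
    refine ContinuousAt.continuousWithinAt ?_
    have h : (fun p : X × G => C.trans j i x * p.2) =ᶠ[𝓝 (x, a)]
        fun p : X × G => C.trans j i p.1 * p.2 := by
      filter_upwards [continuous_fst.continuousAt.eventually (C.flat i j x hx.1 hx.2)] with p hp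
      rw [hp]
    exact ContinuousAt.congr (continuous_const.mul continuous_snd).continuousAt h
  coordChange_comp i j k x hx a := by
    rw [← mul_assoc, C.trans_mul i j k x hx.1.1 hx.1.2 hx.2]

theorem core_localTriv_snd (C : FlatCocycle X G) (i j : C.ι) (p : C.core.TotalSpace)
    (hi : p.proj ∈ C.dom i) (hj : p.proj ∈ C.dom j) :
    (C.core.localTriv j p).2 = C.trans j i p.proj * (C.core.localTriv i p).2 := by
  have h := C.core.coordChange_comp (C.core.indexAt p.proj) i j p.proj
    ⟨⟨C.core.mem_baseSet_at p.proj, hi⟩, hj⟩ p.2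
  exact h.symm

/-- Right multiplication on the bundle of a flat cocycle. -/
def coreRight (C : FlatCocycle X G) (g : G) (p : C.core.TotalSpace) : C.core.TotalSpace :=
  ⟨p.proj, show G from (show G from p.2) * g⟩

theorem localTriv_coreRight (C : FlatCocycle X G) (g : G) (i : C.ι) (p : C.core.TotalSpace) :
    (C.core.localTriv i (C.coreRight g p)).2 = (C.core.localTriv i p).2 * g :=
  (mul_assoc _ _ _).symm

theorem continuous_coreRight (C : FlatCocycle X G) (g : G) : Continuous (C.coreRight g) := by
  rw [continuous_iff_continuousAt]
  intro p
  rw [FiberBundle.continuousAt_totalSpace]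
  refine ⟨C.core.continuous_proj.continuousAt, ?_⟩
  have hp : p ∈ (C.core.localTriv (C.core.indexAt p.proj)).source :=
    (C.core.localTriv _).mem_source.2 (C.core.mem_baseSet_at p.proj)
  have h := ((C.core.localTriv (C.core.indexAt p.proj)).continuousAt hp).snd
  have h2 : ContinuousAt
      (fun q => (C.core.localTriv (C.core.indexAt p.proj) (C.coreRight g q)).2) p := by
    simp only [localTriv_coreRight]
    exact h.mul continuousAt_const
  exact h2

end core

/-- Homotopic maps have cohomologous pullbacks. -/
theorem cohomologous_of_homotopy (C : FlatCocycle Y G) (H : C(unitInterval × X, Y))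
    (φ ψ : C(X, Y)) (h0 : ∀ x, H (0, x) = φ x) (h1 : ∀ x, H (1, x) = ψ x) :
    Cohomologous (C.pullback φ) (C.pullback ψ) := by
  -- The assertion involves no topology on `G`; the discrete one turns the glued bundle into a
  -- covering space.
  let _ : TopologicalSpace G := ⊥
  have : DiscreteTopology G := ⟨rfl⟩
  have cov : IsCoveringMap C.core.proj := FiberBundle.isCoveringMap (F := G) (E := C.core.Fiber)
  let s : ∀ i : C.ι, φ ⁻¹' C.dom i → C.core.TotalSpace := fun i x =>
    (C.core.localTriv i).toOpenPartialHomeomorph.symm (φ x, 1)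
  have hs : ∀ i, Continuous (s i) := fun i => by
    refine (C.core.localTriv i).toOpenPartialHomeomorph.continuousOn_symm.comp_continuous
      ((φ.continuous.comp continuous_subtype_val).prodMk continuous_const) fun x => ?_
    exact (C.core.localTriv i).mem_target.2 x.2
  have hmem : ∀ i (x : φ ⁻¹' C.dom i), (φ x, (1 : G)) ∈ (C.core.localTriv i).target :=
    fun i x => (C.core.localTriv i).mem_target.2 x.2
  have hsp : ∀ i x, C.core.proj (s i x) = φ x := fun i x =>
    (C.core.localTriv i).proj_symm_apply (hmem i x)
  have hs1 : ∀ i x, (C.core.localTriv i (s i x)).2 = 1 := fun i x => by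
    simp only [s]
    rw [(C.core.localTriv i).apply_symm_apply (hmem i x)]
  let Hi : ∀ i, C(unitInterval × (φ ⁻¹' C.dom i), Y) := fun i =>
    ⟨fun p => H (p.1, p.2), by fun_prop⟩
  have hH0 : ∀ i x, Hi i (0, x) = C.core.proj (s i x) := fun i x => by
    rw [hsp]
    exact h0 x
  let K : ∀ i, C(unitInterval × (φ ⁻¹' C.dom i), C.core.TotalSpace) := fun i =>
    cov.liftHomotopy (Hi i) ⟨s i, hs i⟩ (hH0 i)
  have hK : ∀ i t x, C.core.proj (K i (t, x)) = H (t, x) := fun i t x =>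
    congrFun (cov.liftHomotopy_lifts (Hi i) ⟨s i, hs i⟩ (hH0 i)) (t, x)
  have hK0 : ∀ i x, K i (0, x) = s i x := fun i x =>
    cov.liftHomotopy_zero (Hi i) ⟨s i, hs i⟩ (hH0 i) x
  classical
  -- Parallel transport: the section with coordinate `1` in chart `i` is carried along the homotopy,
  -- and its end is read in chart `k`.
  let l : C.ι → C.ι → X → G := fun k i x =>
    if hx : x ∈ φ ⁻¹' C.dom i then (C.core.localTriv k (K i (1, ⟨x, hx⟩))).2 else 1
  have hl : ∀ k i x (hx : x ∈ φ ⁻¹' C.dom i),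
      l k i x = (C.core.localTriv k (K i (1, ⟨x, hx⟩))).2 := fun k i x hx => dif_pos hx
  have hK1 : ∀ i x, C.core.proj (K i (1, x)) = ψ x := fun i x => (hK i 1 x).trans (h1 x)
  have A : ∀ (k i : C.ι) x, φ x ∈ C.dom i → ψ x ∈ C.dom k → ∀ᶠ y in 𝓝 x, l k i y = l k i x := by
    intro k i x hi hk
    have hopen : IsOpen (φ ⁻¹' C.dom i) := (C.isOpen_dom i).preimage φ.continuous
    have hsrc : K i (1, ⟨x, hi⟩) ∈ (C.core.localTriv k).source := by
      rw [(C.core.localTriv k).mem_source, hK1]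
      exact hk
    have hc : ContinuousAt (fun y : φ ⁻¹' C.dom i => (C.core.localTriv k (K i (1, y))).2)
        ⟨x, hi⟩ := by
      have h2 : ContinuousAt (fun y : φ ⁻¹' C.dom i => K i (1, y)) ⟨x, hi⟩ := by fun_prop
      exact (ContinuousAt.comp (f := fun y : φ ⁻¹' C.dom i => K i (1, y))
        ((C.core.localTriv k).continuousAt hsrc) h2).snd
    have hev := hc (mem_nhds_discrete.2 (mem_singleton _))
    have hx : x ∈ φ ⁻¹' C.dom i := hi
    rw [← map_nhds_subtype_coe_eq_nhds hx (hopen.mem_nhds hx)]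
    rw [Filter.eventually_map]
    filter_upwards [hev] with y hy
    rw [hl k i y y.2, hl k i x hi]
    exact hy
  have B : ∀ (i j k : C.ι) x, φ x ∈ C.dom i → φ x ∈ C.dom j → ψ x ∈ C.dom k →
      l k j x * C.trans j i (φ x) = l k i x := by
    intro i j k x hi hj hk
    -- Right multiplication commutes with the left-multiplying transition functions, so both sides
    -- lift the same path. They agree at time `0`, hence always.
    have hpath : (fun t => K i (t, ⟨x, hi⟩)) =
        fun t => C.coreRight (C.trans j i (φ x)) (K j (t, ⟨x, hj⟩)) := by
      refine cov.eq_of_comp_eq (by fun_prop)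
        ((C.continuous_coreRight _).comp (by fun_prop)) ?_ 0 ?_
      · funext t
        exact (hK i t ⟨x, hi⟩).trans (hK j t ⟨x, hj⟩).symm
      · rw [hK0, hK0]
        have e1 : C.core.proj (s i ⟨x, hi⟩) = φ x := hsp _ _
        have e2 : C.core.proj (s j ⟨x, hj⟩) = φ x := hsp _ _
        refine (C.core.localTriv j).injOn ?_ ?_ (Prod.ext ?_ ?_)
        · rw [(C.core.localTriv j).mem_source, e1]
          exact hj
        · rw [(C.core.localTriv j).mem_source]
          exact e2 ▸ hj
        · exact e1.trans e2.symm
        · have hx : C.core.proj (s i ⟨x, hi⟩) ∈ C.dom i ∧ C.core.proj (s i ⟨x, hi⟩) ∈ C.dom j := by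
            rw [e1]
            exact ⟨hi, hj⟩
          refine ((C.core_localTriv_snd i j _ hx.1 hx.2).trans ?_).trans
            (C.localTriv_coreRight _ j _).symm
          rw [hs1, hs1, mul_one, one_mul]
          exact congrArg _ e1
    have h2 : K i (1, ⟨x, hi⟩) = C.coreRight (C.trans j i (φ x)) (K j (1, ⟨x, hj⟩)) :=
      congrFun hpath 1
    rw [hl k j x hj, hl k i x hi, h2, localTriv_coreRight]
  refine ⟨l, A, B, fun i k m x hi hk hm => ?_⟩
  have hx : ψ x ∈ C.dom k ∧ ψ x ∈ C.dom m := ⟨hk, hm⟩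
  rw [← hK1 i ⟨x, hi⟩] at hx
  have h2 := C.core_localTriv_snd k m _ hx.1 hx.2
  rw [hl k i x hi, hl m i x hi, h2]
  exact congrArg (fun z => C.trans m k z * _) (hK1 i ⟨x, hi⟩).symm

end FlatCocycle

variable {L' : Type*} {T : Tiling d L} {T' : Tiling d L'}

/-! ### Extending pattern equivariant functions to the hull -/

namespace Tiling

/-- A point of `T` at which the patch of radius `t` is `p`, if there is one. -/
noncomputable def rep (T : Tiling d L) (t : ℝ) (p : Set (Tile d L)) : E d :=
  Classical.epsilon fun x => p = (T.shift x).patch t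

theorem rep_spec (S : T.Hull) (t : ℝ) : S.1.patch t = (T.shift (T.rep t (S.1.patch t))).patch t :=
  Classical.epsilon_spec (exists_patch_eq_of_mem_hull S.2 t)

theorem IsPESet.mono {t s : ℝ} (h : t ≤ s) {U : Set (E d)} (hU : T.IsPESet t U) :
    T.IsPESet s U := fun x hx y hxy => hU x hx y (patch_eq_of_le h hxy)

theorem IsPESet.inter {t : ℝ} {U V : Set (E d)} (hU : T.IsPESet t U) (hV : T.IsPESet t V) :
    T.IsPESet t (U ∩ V) := fun x hx y hxy => ⟨hU x hx.1 y hxy, hV x hx.2 y hxy⟩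

/-- The extension to the hull of a pattern equivariant function of radius `t`. -/
noncomputable def hullExt {α : Type*} (t : ℝ) (h : E d → α) (S : T.Hull) : α :=
  h (T.rep t (S.1.patch t))

theorem hullExt_eq {α : Type*} {t : ℝ} {h : E d → α} {U : Set (E d)} (hU : T.IsPESet t U)
    (hh : T.IsPEOn t h U) {S : T.Hull} {x : E d} (hx : x ∈ U)
    (hS : S.1.patch t = (T.shift x).patch t) : hullExt t h S = h x := by
  have e := hS.symm.trans (rep_spec S t)
  exact (hh x hx _ (hU x hx _ e) e).symm

/-- A level set of `h` in `U` is open because `h` is locally constant and is again a PE set, so it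
cuts out an open cylinder in the hull. -/
theorem FLC.eventually_hullExt_eq (hT : T.FLC) {α : Type*} {t : ℝ} (ht : 0 < t) {h : E d → α}
    {U : Set (E d)} (hUo : IsOpen U) (hU : T.IsPESet t U) (hh : T.IsPEOn t h U)
    (hflat : IsLocConstOn h U) {S : T.Hull} {x : E d} (hx : x ∈ U)
    (hS : S.1.patch t = (T.shift x).patch t) :
    ∀ᶠ S' in 𝓝 S, hullExt t h S' = hullExt t h S := by
  have hO : IsOpen {y | y ∈ U ∧ h y = h x} := by
    rw [isOpen_iff_mem_nhds]
    rintro y ⟨hy, he⟩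
    filter_upwards [hUo.mem_nhds hy, hflat y hy] with z hz hz'
    exact ⟨hz, hz'.trans he⟩
  have hPE : T.IsPESet t {y | y ∈ U ∧ h y = h x} := by
    rintro y ⟨hy, he⟩ z hyz
    exact ⟨hU y hy z hyz, (hh y hy z (hU y hy z hyz) hyz).symm.trans he⟩
  filter_upwards [(hT.isOpen_cylinder ht hO hPE).mem_nhds ⟨x, ⟨hx, rfl⟩, hS⟩] with S' hS'
  obtain ⟨y, ⟨hy, he⟩, hSy⟩ := hS'
  rw [hullExt_eq hU hh hx hS, hullExt_eq hU hh hy hSy, he]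

end Tiling

/-! ### Bundles as cocycles on the hull -/

namespace FlatPEBundle

open Tiling

variable {G : Type u} [Group G] [TopologicalSpace G]

/-- The cocycle identity is no axiom of the structure; it is read off from a point of the fibre with
coordinate `1`. -/
theorem trans_mul (P : FlatPEBundle T G) (i j k : P.ι) (x : E d) (hi : x ∈ (P.chart i).baseSet)
    (hj : x ∈ (P.chart j).baseSet) (hk : x ∈ (P.chart k).baseSet) :
    P.trans k j x * P.trans j i x = P.trans k i x := by
  obtain ⟨p, rfl, h1⟩ := P.exists_proj_eq hi
  have e1 := P.chart_eq i j p hi hj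
  have e2 := P.chart_eq j k p hj hk
  have e3 := P.chart_eq i k p hi hk
  rw [e1, e3, h1, mul_one, mul_one] at e2
  exact e2.symm

theorem eq_of_chart_eq (P : FlatPEBundle T G) {i : P.ι} {p q : P.Total}
    (hi : P.proj p ∈ (P.chart i).baseSet) (hpq : P.proj p = P.proj q)
    (h : (P.chart i p).2 = (P.chart i q).2) : p = q := by
  have hp := (P.chart i).mem_source.2 hi
  have hq := (P.chart i).mem_source.2 (hpq ▸ hi)
  refine (P.chart i).injOn hp hq (Prod.ext ?_ h)
  exact ((P.chart i).coe_fst hp).trans (hpq.trans ((P.chart i).coe_fst hq).symm)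

/-- The flat cocycle on the hull defined by a flat pattern equivariant bundle. -/
noncomputable def cech (P : FlatPEBundle T G) (hT : T.FLC) : FlatCocycle T.Hull G where
  ι := P.ι
  dom i := {S | ∃ x ∈ (P.chart i).baseSet, S.1.patch P.radius = (T.shift x).patch P.radius}
  isOpen_dom i := hT.isOpen_cylinder P.radius_pos (P.chart i).open_baseSet (P.isPE_baseSet i)
  covers S := by
    obtain ⟨i, hi⟩ := P.covers (T.rep P.radius (S.1.patch P.radius))
    exact ⟨i, _, hi, rep_spec S _⟩
  trans j i := hullExt P.radius (P.trans j i)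
  trans_mul i j k S := by
    rintro ⟨x, hx, hi⟩ ⟨y, hy, hj⟩ ⟨z, hz, hk⟩
    exact P.trans_mul i j k _ (P.isPE_baseSet i x hx _ (hi.symm.trans (rep_spec S _)))
      (P.isPE_baseSet j y hy _ (hj.symm.trans (rep_spec S _)))
      (P.isPE_baseSet k z hz _ (hk.symm.trans (rep_spec S _)))
  flat i j S := by
    rintro ⟨x, hx, hi⟩ ⟨y, hy, hj⟩
    exact hT.eventually_hullExt_eq P.radius_pos
      ((P.chart i).open_baseSet.inter (P.chart j).open_baseSet)
      ((P.isPE_baseSet i).inter (P.isPE_baseSet j)) (P.isPE_trans i j) (P.flat_trans i j)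
      ⟨hx, P.isPE_baseSet j y hy _ (hj.symm.trans hi)⟩ hi

theorem mem_cech_dom_iff (P : FlatPEBundle T G) (hT : T.FLC) {i : P.ι} {S : T.Hull} {x : E d}
    (h : S.1.patch P.radius = (T.shift x).patch P.radius) :
    S ∈ (P.cech hT).dom i ↔ x ∈ (P.chart i).baseSet :=
  ⟨fun ⟨y, hy, hSy⟩ => P.isPE_baseSet i y hy x (hSy.symm.trans h), fun hx => ⟨x, hx, h⟩⟩

theorem cech_trans (P : FlatPEBundle T G) (hT : T.FLC) {i j : P.ι} {S : T.Hull} {x : E d}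
    (h : S.1.patch P.radius = (T.shift x).patch P.radius) (hi : x ∈ (P.chart i).baseSet)
    (hj : x ∈ (P.chart j).baseSet) : (P.cech hT).trans j i S = P.trans j i x :=
  hullExt_eq ((P.isPE_baseSet i).inter (P.isPE_baseSet j)) (P.isPE_trans i j) ⟨hi, hj⟩ h

theorem mem_cech_dom_congr (P : FlatPEBundle T G) (hT : T.FLC) {i : P.ι} {S S' : T.Hull}
    (h : S.1.patch P.radius = S'.1.patch P.radius) :
    S ∈ (P.cech hT).dom i ↔ S' ∈ (P.cech hT).dom i := by
  simp only [cech, mem_ofPred_eq, h]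

theorem cech_trans_congr (P : FlatPEBundle T G) (hT : T.FLC) {i j : P.ι} {S S' : T.Hull}
    (h : S.1.patch P.radius = S'.1.patch P.radius) :
    (P.cech hT).trans j i S = (P.cech hT).trans j i S' := by
  simp only [cech, hullExt, h]

/-- A map of total spaces glued from locally constant functions in charts. -/
theorem exists_bundle_map [ContinuousMul G] (P : FlatPEBundle T G) (R : FlatPEBundle T' G)
    {a : E d → E d} (ha : Continuous a) (m : R.ι → P.ι → E d → G)
    (hflat : ∀ k i x, x ∈ (P.chart i).baseSet → a x ∈ (R.chart k).baseSet →
      ∀ᶠ y in 𝓝 x, m k i y = m k i x)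
    (h1 : ∀ i j k x, x ∈ (P.chart i).baseSet → x ∈ (P.chart j).baseSet →
      a x ∈ (R.chart k).baseSet → m k j x * P.trans j i x = m k i x)
    (h2 : ∀ i k n x, x ∈ (P.chart i).baseSet → a x ∈ (R.chart k).baseSet →
      a x ∈ (R.chart n).baseSet → R.trans n k (a x) * m k i x = m n i x) :
    ∃ F : P.Total → R.Total, Continuous F ∧ (∀ p, R.proj (F p) = a (P.proj p)) ∧
      ∀ k i p, P.proj p ∈ (P.chart i).baseSet → a (P.proj p) ∈ (R.chart k).baseSet →
        (R.chart k (F p)).2 = m k i (P.proj p) * (P.chart i p).2 := by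
  choose ip hip using P.covers
  choose kr hkr using R.covers
  have hmem : ∀ p g, (a (P.proj p), g) ∈ (R.chart (kr (a (P.proj p)))).target := fun p g =>
    (R.chart _).mem_target.2 (hkr _)
  let F : P.Total → R.Total := fun p =>
    (R.chart (kr (a (P.proj p)))).toOpenPartialHomeomorph.symm
      (a (P.proj p), m (kr (a (P.proj p))) (ip (P.proj p)) (P.proj p) *
        (P.chart (ip (P.proj p)) p).2)
  have hproj : ∀ p, R.proj (F p) = a (P.proj p) := fun p =>
    (R.chart _).proj_symm_apply (hmem p _)
  have hchart : ∀ k i p, P.proj p ∈ (P.chart i).baseSet → a (P.proj p) ∈ (R.chart k).baseSet →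
      (R.chart k (F p)).2 = m k i (P.proj p) * (P.chart i p).2 := by
    intro k i p hi hk
    have e0 : (R.chart (kr (a (P.proj p))) (F p)).2 =
        m (kr (a (P.proj p))) (ip (P.proj p)) (P.proj p) * (P.chart (ip (P.proj p)) p).2 := by
      simp only [F]
      rw [(R.chart _).apply_symm_apply (hmem p _)]
    rw [R.chart_eq (kr (a (P.proj p))) k (F p) (by rw [hproj]; exact hkr _) (by rwa [hproj]), e0,
      hproj, ← mul_assoc, h2 _ _ _ _ (hip _) (hkr _) hk, P.chart_eq i _ p hi (hip _), ← mul_assoc,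
      h1 _ _ _ _ hi (hip _) hk]
  refine ⟨F, ?_, hproj, hchart⟩
  rw [continuous_iff_continuousAt]
  intro p
  obtain ⟨i, hi⟩ := P.covers (P.proj p)
  obtain ⟨k, hk⟩ := R.covers (a (P.proj p))
  have hsrc := (P.chart i).mem_source.2 hi
  have hpc : ContinuousAt P.proj p := (P.chart i).continuousAt_proj hsrc
  have hac : ContinuousAt (fun q => a (P.proj q)) p := ha.continuousAt.comp hpc
  -- The gauge factor is frozen at `P.proj p`. Near `p` this changes nothing, because `m k i` is
  -- locally constant.
  have hcoord : ContinuousAt (fun q => ((a (P.proj q), m k i (P.proj p) * (P.chart i q).2) :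
      E d × G)) p :=
    hac.prodMk (continuousAt_const.mul ((P.chart i).continuousAt hsrc).snd)
  have hsymm : ContinuousAt (fun q => (R.chart k).toOpenPartialHomeomorph.symm
      (a (P.proj q), m k i (P.proj p) * (P.chart i q).2)) p :=
    ContinuousAt.comp (f := fun q => ((a (P.proj q), m k i (P.proj p) * (P.chart i q).2) :
      E d × G)) ((R.chart k).toOpenPartialHomeomorph.continuousAt_symm
        ((R.chart k).mem_target.2 hk)) hcoord
  refine hsymm.congr ?_
  filter_upwards [hpc ((P.chart i).open_baseSet.mem_nhds hi),
    hac ((R.chart k).open_baseSet.mem_nhds hk), hpc.eventually (hflat k i _ hi hk)]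
    with q hqi hqk hqm
  have hqt := (R.chart k).mem_target (x := (a (P.proj q), m k i (P.proj p) * (P.chart i q).2)).2 hqk
  refine R.eq_of_chart_eq (i := k) ?_ ?_ ?_
  · rw [(R.chart k).proj_symm_apply hqt]
    exact hqk
  · rw [(R.chart k).proj_symm_apply hqt, hproj]
  · rw [(R.chart k).apply_symm_apply hqt, hchart k i q hqi hqk, hqm]

/-- The gauge functions of the isomorphism extend to the hull at radius `s`. As `s` bounds both
bundle radii, an orbit point with the same `s`-patch decides chart membership for both, and the
relations can be checked there. -/
theorem Equivalent.cohomologous {P R : FlatPEBundle T G} (hT : T.FLC) (h : Equivalent P R) :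
    FlatCocycle.Cohomologous (P.cech hT) (R.cech hT) := by
  obtain ⟨s, hP, hR, Θ, hΘ, hl⟩ := h
  choose l hpe hflat he using hl
  have hs : 0 < s := P.radius_pos.trans_le hP
  have hrep : ∀ S : T.Hull, S.1.patch s = (T.shift (T.rep s (S.1.patch s))).patch s :=
    fun S => rep_spec S s
  have memP : ∀ i (S : T.Hull), S ∈ (P.cech hT).dom i →
      T.rep s (S.1.patch s) ∈ (P.chart i).baseSet := fun i S hS =>
    (P.mem_cech_dom_iff hT (patch_eq_of_le hP (hrep S))).1 hS
  have memR : ∀ k (S : T.Hull), S ∈ (R.cech hT).dom k →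
      T.rep s (S.1.patch s) ∈ (R.chart k).baseSet := fun k S hS =>
    (R.mem_cech_dom_iff hT (patch_eq_of_le hR (hrep S))).1 hS
  refine ⟨fun k i => hullExt s (l i k), fun k i S hi hk => ?_, fun i j k S hi hj hk => ?_,
    fun i k m S hi hk hm => ?_⟩
  · exact hT.eventually_hullExt_eq hs ((P.chart i).open_baseSet.inter (R.chart k).open_baseSet)
      (((P.isPE_baseSet i).mono hP).inter ((R.isPE_baseSet k).mono hR)) (hpe i k) (hflat i k)
      ⟨memP i S hi, memR k S hk⟩ (hrep S)
  · have hxi := memP i S hi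
    have hxj := memP j S hj
    have hxk := memR k S hk
    rw [P.cech_trans hT (patch_eq_of_le hP (hrep S)) hxi hxj]
    simp only [hullExt]
    obtain ⟨p, hp, h1⟩ := P.exists_proj_eq hxi
    rw [← hp] at hxi hxj hxk ⊢
    have e1 := he i k p hxi hxk
    rw [he j k p hxj hxk, P.chart_eq i j p hxi hxj, h1, mul_one, mul_one] at e1
    exact e1
  · have hxi := memP i S hi
    have hxk := memR k S hk
    have hxm := memR m S hm
    rw [R.cech_trans hT (patch_eq_of_le hR (hrep S)) hxk hxm]
    simp only [hullExt]
    obtain ⟨p, hp, h1⟩ := P.exists_proj_eq hxi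
    rw [← hp] at hxi hxk hxm ⊢
    have e1 := R.chart_eq k m (Θ p) (by rwa [hΘ]) (by rwa [hΘ])
    rw [he i k p hxi hxk, he i m p hxi hxm, h1, mul_one, mul_one, hΘ] at e1
    exact e1.symm

/-- Restricting the gauge functions to the orbit gives mutually inverse bundle maps. What needs
compactness is pattern equivariance: a locally constant gauge function on the hull has no radius in
advance. -/
theorem equivalent_of_cohomologous [ContinuousMul G] {P R : FlatPEBundle T G} (hT : T.FLC)
    (h : FlatCocycle.Cohomologous (P.cech hT) (R.cech hT)) : Equivalent P R := by
  obtain ⟨l, hflat, h1, h2⟩ := h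
  have mP : ∀ i x, T.orbitPt x ∈ (P.cech hT).dom i ↔ x ∈ (P.chart i).baseSet := fun i x =>
    P.mem_cech_dom_iff hT rfl
  have mR : ∀ k x, T.orbitPt x ∈ (R.cech hT).dom k ↔ x ∈ (R.chart k).baseSet := fun k x =>
    R.mem_cech_dom_iff hT rfl
  let n : R.ι → P.ι → E d → G := fun k i x => l k i (T.orbitPt x)
  have n1 : ∀ i j k x, x ∈ (P.chart i).baseSet → x ∈ (P.chart j).baseSet →
      x ∈ (R.chart k).baseSet → n k j x * P.trans j i x = n k i x := by
    intro i j k x hi hj hk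
    rw [← P.cech_trans hT (S := T.orbitPt x) rfl hi hj]
    exact h1 i j k _ ((mP _ _).2 hi) ((mP _ _).2 hj) ((mR _ _).2 hk)
  have n2 : ∀ i k m x, x ∈ (P.chart i).baseSet → x ∈ (R.chart k).baseSet →
      x ∈ (R.chart m).baseSet → R.trans m k x * n k i x = n m i x := by
    intro i k m x hi hk hm
    rw [← R.cech_trans hT (S := T.orbitPt x) rfl hk hm]
    exact h2 i k m _ ((mP _ _).2 hi) ((mR _ _).2 hk) ((mR _ _).2 hm)
  have nflat : ∀ k i x, x ∈ (P.chart i).baseSet → x ∈ (R.chart k).baseSet →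
      ∀ᶠ y in 𝓝 x, n k i y = n k i x := fun k i x hi hk =>
    (continuous_orbitPt T).continuousAt.eventually
      (hflat k i (T.orbitPt x) ((mP _ _).2 hi) ((mR _ _).2 hk))
  obtain ⟨Θ, hΘc, hΘp, hΘ⟩ := exists_bundle_map P R continuous_id n nflat n1 n2
  obtain ⟨Θ', hΘc', hΘp', hΘ'⟩ := exists_bundle_map R P continuous_id (fun i k x => (n k i x)⁻¹)
    (fun i k x hk hi => (nflat k i x hi hk).mono fun y hy => by rw [hy])
    (fun k m i x hk hm hi => by
      rw [← n2 i k m x hi hk hm, mul_inv_rev, inv_mul_cancel_right])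
    (fun k i j x hk hi hj => by
      simp only [id]
      rw [← n1 i j k x hi hj hk, mul_inv_rev, mul_inv_cancel_left])
  simp only [id] at hΘp hΘ hΘp' hΘ'
  have hleft : ∀ p, Θ' (Θ p) = p := by
    intro p
    obtain ⟨i, hi⟩ := P.covers (P.proj p)
    obtain ⟨k, hk⟩ := R.covers (P.proj p)
    refine P.eq_of_chart_eq (i := i) (by rwa [hΘp', hΘp]) (by rw [hΘp', hΘp]) ?_
    rw [hΘ' i k _ (by rwa [hΘp]) (by rwa [hΘp]), hΘ k i p hi hk, hΘp, inv_mul_cancel_left]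
  have hright : ∀ q, Θ (Θ' q) = q := by
    intro q
    obtain ⟨i, hi⟩ := P.covers (R.proj q)
    obtain ⟨k, hk⟩ := R.covers (R.proj q)
    refine R.eq_of_chart_eq (i := k) (by rwa [hΘp, hΘp']) (by rw [hΘp, hΘp']) ?_
    rw [hΘ k i _ (by rwa [hΘp']) (by rwa [hΘp']), hΘ' i k q hk hi, hΘp', mul_inv_cancel_left]
  choose iS hiS using (P.cech hT).covers
  choose kS hkS using (R.cech hT).covers
  -- Around each `S` one pair of charts is fixed and its gauge function is constant; agreement up to
  -- `s₀` puts two tilings in a common such set.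
  obtain ⟨s₀, -, hleb⟩ := hT.exists_lebesgue_radius
    (fun S => {S' | S' ∈ (P.cech hT).dom (iS S) ∧ S' ∈ (R.cech hT).dom (kS S) ∧
      l (kS S) (iS S) S' = l (kS S) (iS S) S}) fun S => by
    filter_upwards [((P.cech hT).isOpen_dom (iS S)).mem_nhds (hiS S),
      ((R.cech hT).isOpen_dom (kS S)).mem_nhds (hkS S), hflat _ _ S (hiS S) (hkS S)]
      with S' h3 h4 h5
    exact ⟨h3, h4, h5⟩
  refine ⟨max s₀ (max P.radius R.radius), (le_max_left _ _).trans (le_max_right _ _),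
    (le_max_right _ _).trans (le_max_right _ _), ⟨⟨Θ, Θ', hleft, hright⟩, hΘc, hΘc'⟩, hΘp,
    fun i k => ⟨n k i, ?_, fun x hx => nflat k i x hx.1 hx.2, fun p hi hk => hΘ k i p hi hk⟩⟩
  intro x hx y hy hxy
  have hP := patch_eq_of_le ((le_max_left P.radius R.radius).trans (le_max_right s₀ _)) hxy
  have hR := patch_eq_of_le ((le_max_right P.radius R.radius).trans (le_max_right s₀ _)) hxy
  obtain ⟨S₀, hS₀⟩ := hleb (T.orbitPt x)
  obtain ⟨x1, x2, x3⟩ := hS₀ (T.orbitPt x) rfl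
  obtain ⟨y1, y2, y3⟩ := hS₀ (T.orbitPt y) (patch_eq_of_le (le_max_left _ _) hxy.symm)
  -- Any other pair of charts differs from the fixed one by transition functions, which are already
  -- pattern equivariant.
  have key : ∀ z, z ∈ (P.chart i).baseSet → z ∈ (R.chart k).baseSet →
      z ∈ (P.chart (iS S₀)).baseSet → z ∈ (R.chart (kS S₀)).baseSet →
      n k i z = R.trans k (kS S₀) z * n (kS S₀) (iS S₀) z * P.trans (iS S₀) i z := by
    intro z z1 z2 z3 z4
    rw [n2 _ _ _ z z3 z4 z2, n1 _ _ _ z z1 z3 z2]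
  rw [mP] at x1 y1
  rw [mR] at x2 y2
  rw [key x hx.1 hx.2 x1 x2, key y hy.1 hy.2 y1 y2, P.isPE_trans _ _ x ⟨hx.1, x1⟩ y ⟨hy.1, y1⟩ hP,
    R.isPE_trans _ _ x ⟨x2, hx.2⟩ y ⟨y2, hy.2⟩ hR]
  simp only [n]
  rw [x3, y3]

/-- The flat pattern equivariant bundle glued from a pattern equivariant flat cocycle. -/
noncomputable def ofCocycle [ContinuousMul G] (C : FlatCocycle (E d) G) (r : ℝ) (hr : 0 < r)
    (hdom : ∀ i, T.IsPESet r (C.dom i))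
    (htrans : ∀ i j, T.IsPEOn r (C.trans j i) (C.dom i ∩ C.dom j)) : FlatPEBundle T G where
  Total := C.core.TotalSpace
  proj := C.core.proj
  radius := r
  radius_pos := hr
  ι := C.ι
  chart := C.core.localTriv
  covers := C.covers
  isPE_baseSet := hdom
  trans := C.trans
  chart_eq i j p hi hj := C.core_localTriv_snd i j p hi hj
  isPE_trans := htrans
  flat_trans i j x hx := C.flat i j x hx.1 hx.2

end FlatPEBundle

/-! ### Pullbacks along local maps -/

section maps

open Tiling

variable {G : Type u} [Group G] [TopologicalSpace G] {g : T.Hull → T'.Hull}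

/-- The cocycle of `P'` is pulled back along `x ↦ g (T - x)` and glued over `ℝ^d`. Locality of `g`
at the radius of `P'` supplies the radius of the new bundle. -/
theorem exists_isPullback [ContinuousMul G] (hT' : T'.FLC) (hg : Continuous g) (hl : IsLocalMap g)
    (P' : FlatPEBundle T' G) : ∃ P : FlatPEBundle T G, IsPullback g P' P := by
  obtain ⟨r, hr, hloc⟩ := hl P'.radius P'.radius_pos
  let φ : C(E d, T'.Hull) := ⟨fun x => g (T.orbitPt x), hg.comp (continuous_orbitPt T)⟩
  have hφ : ∀ x y, (T.shift x).patch r = (T.shift y).patch r →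
      (φ x).1.patch P'.radius = (φ y).1.patch P'.radius := fun x y h => hloc _ _ h
  let P : FlatPEBundle T G := FlatPEBundle.ofCocycle ((P'.cech hT').pullback φ) r hr
    (fun i x hx y hxy => (P'.mem_cech_dom_congr hT' (hφ x y hxy)).1 hx)
    (fun i j x _ y _ hxy => P'.cech_trans_congr hT' (hφ x y hxy))
  exact ⟨P, Equiv.refl P'.ι, fun i => rfl, fun i j x y hi hj h => P'.cech_trans hT' h hi hj⟩

/-- On the orbit the two cocycles agree by the definition of a pullback. Both depend only on
patches, by locality of `g`, and every patch in the hull occurs in `T`, so they agree everywhere. -/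
theorem IsPullback.cohomologous (hT : T.FLC) (hT' : T'.FLC) (hg : Continuous g)
    (hl : IsLocalMap g) {P' : FlatPEBundle T' G} {P : FlatPEBundle T G} (h : IsPullback g P' P) :
    FlatCocycle.Cohomologous (P.cech hT) ((P'.cech hT').pullback ⟨g, hg⟩) := by
  obtain ⟨e, hbase, htrans⟩ := h
  obtain ⟨r, hr, hloc⟩ := hl P'.radius P'.radius_pos
  have hx : ∀ S : T.Hull, ∃ x, S.1.patch P.radius = (T.shift x).patch P.radius ∧
      (g S).1.patch P'.radius = (g (T.orbitPt x)).1.patch P'.radius := by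
    intro S
    obtain ⟨x, hx⟩ := exists_patch_eq_of_mem_hull S.2 (max P.radius r)
    exact ⟨x, patch_eq_of_le (le_max_left _ _) hx,
      hloc _ _ (patch_eq_of_le (le_max_right _ _) hx)⟩
  have hmem : ∀ i x, x ∈ (P.chart i).baseSet ↔ g (T.orbitPt x) ∈ (P'.cech hT').dom (e i) := by
    intro i x
    rw [hbase]
    rfl
  have hdom : ∀ (i : P.ι) S, S ∈ (P.cech hT).dom i ↔ g S ∈ (P'.cech hT').dom (e i) := by
    intro i S
    obtain ⟨x, h1, h2⟩ := hx S
    rw [P.mem_cech_dom_iff hT h1, hmem, ← P'.mem_cech_dom_congr hT' h2]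
  have htr : ∀ (i j : P.ι) S, S ∈ (P.cech hT).dom i → S ∈ (P.cech hT).dom j →
      (P.cech hT).trans j i S = (P'.cech hT').trans (e j) (e i) (g S) := by
    intro i j S hi hj
    obtain ⟨x, h1, h2⟩ := hx S
    rw [P.mem_cech_dom_iff hT h1] at hi hj
    have hi' := hi
    have hj' := hj
    rw [hmem] at hi' hj'
    have h3 := rep_spec (g (T.orbitPt x)) P'.radius
    rw [P'.mem_cech_dom_iff hT' h3] at hi' hj'
    rw [P.cech_trans hT h1 hi hj, htrans i j x _ hi' hj' h3]
    exact (P'.cech_trans hT' (h2.trans h3) hi' hj').symm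
  exact FlatCocycle.Cohomologous.of_equiv (C := P.cech hT)
    (D := (P'.cech hT').pullback ⟨g, hg⟩) e (fun i => Set.ext (hdom i)) htr

variable {a : E d → E d}

/-- Any admissible `y` shows the same patch as `a x`, so pattern equivariance of `P'` allows
replacing one by the other. -/
theorem IsPullbackAlong.isPullback (hga : ∀ x, (g (T.orbitPt x)).1 = T'.shift (a x))
    {P' : FlatPEBundle T' G} {P : FlatPEBundle T G} (h : IsPullbackAlong a P' P) :
    IsPullback g P' P := by
  obtain ⟨e, F, -, hF, hbase, hchart⟩ := h
  refine ⟨e, fun i => ?_, fun i j x y hi hj hxy => ?_⟩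
  · ext x
    rw [hbase]
    constructor
    · intro hx
      exact ⟨a x, hx, by rw [hga]⟩
    · rintro ⟨y, hy, hxy⟩
      rw [hga] at hxy
      exact P'.isPE_baseSet _ y hy _ hxy.symm
  · rw [hga] at hxy
    have hai := P'.isPE_baseSet _ y hi _ hxy.symm
    have haj := P'.isPE_baseSet _ y hj _ hxy.symm
    have hxi : x ∈ (P.chart i).baseSet := by rw [hbase]; exact hai
    have hxj : x ∈ (P.chart j).baseSet := by rw [hbase]; exact haj
    rw [← P'.isPE_trans _ _ (a x) ⟨hai, haj⟩ y ⟨hi, hj⟩ hxy]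
    obtain ⟨p, rfl, h1⟩ := P.exists_proj_eq hxi
    have e1 := P'.chart_eq (e i) (e j) (F p) (by rwa [hF]) (by rwa [hF])
    rw [hchart i p hxi, hchart j p hxj, P.chart_eq i j p hxi hxj, h1, mul_one, mul_one, hF] at e1
    exact e1

theorem IsPullback.isPullbackAlong [ContinuousMul G] (ha : Continuous a)
    (hga : ∀ x, (g (T.orbitPt x)).1 = T'.shift (a x)) {P' : FlatPEBundle T' G}
    {P : FlatPEBundle T G} (h : IsPullback g P' P) : IsPullbackAlong a P' P := by
  obtain ⟨e, hbase, htrans⟩ := h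
  have hmem : ∀ i, (P.chart i).baseSet = a ⁻¹' (P'.chart (e i)).baseSet := by
    intro i
    ext x
    rw [hbase]
    constructor
    · rintro ⟨y, hy, hxy⟩
      rw [hga] at hxy
      exact P'.isPE_baseSet _ y hy _ hxy.symm
    · intro hx
      exact ⟨a x, hx, by rw [hga]⟩
  obtain ⟨F, hFc, hFp, hF⟩ := FlatPEBundle.exists_bundle_map P P' ha
    (fun k i x => P'.trans k (e i) (a x))
    (fun k i x hi hk => by
      rw [hmem] at hi
      exact ha.continuousAt.eventually (P'.flat_trans (e i) k (a x) ⟨hi, hk⟩))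
    (fun i j k x hi hj hk => by
      rw [hmem] at hi hj
      rw [htrans i j x (a x) hi hj (by rw [hga])]
      exact P'.trans_mul _ _ _ _ hi hj hk)
    (fun i k n x hi hk hn => by
      rw [hmem] at hi
      exact P'.trans_mul _ _ _ _ hi hk hn)
  refine ⟨e, F, hFc, hFp, hmem, fun i p hi => ?_⟩
  have hi' := hi
  rw [hmem] at hi'
  rw [hF (e i) i p hi hi']
  have h1 := P'.trans_mul (e i) (e i) (e i) _ hi' hi' hi'
  rw [mul_eq_left] at h1
  rw [h1, one_mul]

end maps

/-! ### Rigidity and translation coordinates on boxes -/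

namespace Tiling

/-- Translates of a tiling in the hull by vectors less than `ρ` apart have different patches. -/
def IsRigid (T : Tiling d L) (ρ : ℝ) : Prop :=
  ∀ S ∈ T.Hull, ∀ s > 0, ∀ u v : E d, (S.shift u).patch s = (S.shift v).patch s →
    ‖u - v‖ < ρ → u = v

open Classical in
/-- The translation that carries a tiling of the box to one that agrees with the centre. -/
noncomputable def boxVec (s η : ℝ) (S S' : Tiling d L) : E d :=
  if ∃ w : E d, ‖w‖ < η ∧ (S'.shift w).patch s = S.patch s then
    Classical.epsilon fun w : E d => ‖w‖ < η ∧ (S'.shift w).patch s = S.patch s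
  -- With this default the norm bound holds outside the box too, so averages may run over all
  -- centres.
  else 0

theorem boxVec_spec {s η : ℝ} {S S' : Tiling d L} (h : S' ∈ box s η S) :
    ‖boxVec s η S S'‖ < η ∧ (S'.shift (boxVec s η S S')).patch s = S.patch s := by
  have h' : ∃ w : E d, ‖w‖ < η ∧ (S'.shift w).patch s = S.patch s := h
  rw [boxVec, if_pos h']
  exact Classical.epsilon_spec h

theorem norm_boxVec_lt {s η : ℝ} (hη : 0 < η) (S S' : Tiling d L) : ‖boxVec s η S S'‖ < η := by
  by_cases h : ∃ w : E d, ‖w‖ < η ∧ (S'.shift w).patch s = S.patch s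
  · exact (boxVec_spec h).1
  · rw [boxVec, if_neg h, norm_zero]
    exact hη

/-- The predicate that selects the vector sees only the patch of radius `s + η`, so for both tilings
the same choice is made. -/
theorem box_boxVec_congr {s η r : ℝ} {S S₁ S₂ : Tiling d L} (h : S₁.patch r = S₂.patch r)
    (hr : s + η ≤ r) : (S₁ ∈ box s η S ↔ S₂ ∈ box s η S) ∧
      boxVec s η S S₁ = boxVec s η S S₂ := by
  have hp : (fun w : E d => ‖w‖ < η ∧ (S₁.shift w).patch s = S.patch s) =
      fun w : E d => ‖w‖ < η ∧ (S₂.shift w).patch s = S.patch s := by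
    funext w
    refine propext (and_congr_right fun hw => ?_)
    rw [patch_shift_congr h (by linarith)]
  constructor
  · exact iff_of_eq (congrArg (fun p : E d → Prop => ∃ w, p w) hp)
  · rw [boxVec, boxVec, hp]

variable {ρ : ℝ}

/-- Two candidates of norm below `η` differ by less than `ρ`, so rigidity leaves only one. -/
theorem IsRigid.boxVec_eq (hρ : T.IsRigid ρ) {s η : ℝ} (hs : 0 < s) (hη : 2 * η ≤ ρ)
    {S S' : Tiling d L} (hS' : S' ∈ T.Hull) {w : E d} (hw : ‖w‖ < η)
    (h : (S'.shift w).patch s = S.patch s) : boxVec s η S S' = w := by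
  obtain ⟨h1, h2⟩ := boxVec_spec (⟨w, hw, h⟩ : S' ∈ box s η S)
  refine hρ S' hS' s hs _ _ (h2.trans h.symm) ?_
  linarith [norm_sub_le (boxVec s η S S') w]

/-- A tiling near `S'` is a small translate by `-p` on a large ball, so by uniqueness its vector is
`p + v`. The translation coordinate is thus continuous, while each patch of the transversal
coordinate is locally constant. -/
theorem IsRigid.eventually_boxVec (hρ : T.IsRigid ρ) {s η : ℝ} (hs : 0 < s) (hη : 2 * η ≤ ρ)
    {S : Tiling d L} {S' : T.Hull} (h : S'.1 ∈ box s η S) (R : ℝ) {κ : ℝ} (hκ : 0 < κ) :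
    ∀ᶠ S'' in 𝓝 S', S''.1 ∈ box s η S ∧ ‖boxVec s η S S''.1 - boxVec s η S S'.1‖ < κ ∧
      (S''.1.shift (boxVec s η S S''.1)).patch R = (S'.1.shift (boxVec s η S S'.1)).patch R := by
  obtain ⟨h1, h2⟩ := boxVec_spec h
  set v := boxVec s η S S'.1
  have hκ' : 0 < min κ (η - ‖v‖) := lt_min hκ (by linarith)
  filter_upwards [box_mem_nhds_hull (s := max s R + ‖v‖) hκ' S'] with S'' ⟨p, hp, hS''⟩
  have e1 : (S''.1.shift (p + v)).patch (max s R) = (S'.1.shift v).patch (max s R) := by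
    rw [← shift_shift]
    exact patch_shift_congr hS'' le_rfl
  have e2 : ‖p + v‖ < η := by
    linarith [norm_add_le p v, min_le_right κ (η - ‖v‖)]
  have e3 : (S''.1.shift (p + v)).patch s = S.patch s :=
    (patch_eq_of_le (le_max_left _ _) e1).trans h2
  have e4 := hρ.boxVec_eq hs hη S''.2 e2 e3
  refine ⟨⟨_, e2, e3⟩, ?_, ?_⟩
  · rw [e4, add_sub_cancel_right]
    exact hp.trans_le (min_le_left _ _)
  · rw [e4]
    exact patch_eq_of_le (le_max_right _ _) e1

theorem IsRigid.continuousAt_boxVec (hρ : T.IsRigid ρ) {s η : ℝ} (hs : 0 < s) (hη : 2 * η ≤ ρ)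
    {S : Tiling d L} {S' : T.Hull} (h : S'.1 ∈ box s η S) :
    ContinuousAt (fun S'' : T.Hull => boxVec s η S S''.1) S' := by
  rw [Metric.continuousAt_iff']
  intro κ hκ
  filter_upwards [hρ.eventually_boxVec hs hη h 0 hκ] with S'' hS''
  rw [dist_eq_norm]
  exact hS''.2.1

/-- The small translation between two continuous maps that differ by small translations is
continuous. -/
theorem IsRigid.continuous_gap (hρ : T.IsRigid ρ) (hρ0 : 0 < ρ) {X : Type*} [TopologicalSpace X]
    {f g : X → T.Hull} (hf : Continuous f) (hg : Continuous g) {w : X → E d}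
    (hw : ∀ x, ‖w x‖ < ρ / 4) (hfg : ∀ x, (g x).1 = (f x).1.shift (w x)) : Continuous w := by
  rw [continuous_iff_continuousAt]
  intro x
  rw [Metric.continuousAt_iff']
  intro κ hκ
  have hη : 0 < min (κ / 2) (ρ / 4) := lt_min (by linarith) (by linarith)
  filter_upwards [hf.continuousAt.eventually (box_mem_nhds_hull (s := 1 + ρ) hη (f x)),
    hg.continuousAt.eventually (box_mem_nhds_hull (s := 1) hη (g x))]
    with x' ⟨p, hp, hp'⟩ ⟨q, hq, hq'⟩
  have hwx := hw x
  have hwx' := hw x'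
  have m1 := min_le_left (κ / 2) (ρ / 4)
  have m2 := min_le_right (κ / 2) (ρ / 4)
  have e1 : ((f x').1.shift (w x' + q)).patch 1 = ((f x').1.shift (p + w x)).patch 1 := by
    rw [← shift_shift, ← hfg, hq', hfg, ← shift_shift]
    exact (patch_shift_congr hp' (by linarith)).symm
  -- Each of the four vectors has norm below `ρ / 4`, so rigidity applies.
  have e2 : w x' + q = p + w x := by
    refine hρ _ (f x').2 1 one_pos _ _ e1 ?_
    linarith [norm_sub_le (w x' + q) (p + w x), norm_add_le (w x') q, norm_add_le p (w x)]
  rw [dist_eq_norm, show w x' - w x = p - q by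
    rw [sub_eq_sub_iff_add_eq_add, e2]]
  linarith [norm_sub_le p q]

/-! ### Lifting continuous maps to leaves -/

/-- A continuous map from a preconnected space into a box has its values in one leaf. -/
theorem IsRigid.shift_boxVec_eq (hρ : T.IsRigid ρ) {s η : ℝ} (hs : 0 < s) (hη : 2 * η ≤ ρ)
    {X : Type*} [TopologicalSpace X] [PreconnectedSpace X] {γ : X → T.Hull} (hγ : Continuous γ)
    {S : Tiling d L} (hbox : ∀ x, (γ x).1 ∈ box s η S) (x y : X) :
    (γ x).1.shift (boxVec s η S (γ x).1) = (γ y).1.shift (boxVec s η S (γ y).1) := by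
  refine eq_of_patch_eq fun R _ => ?_
  have hloc : IsLocallyConstant fun x => ((γ x).1.shift (boxVec s η S (γ x).1)).patch R := by
    rw [IsLocallyConstant.iff_eventually_eq]
    intro x
    filter_upwards [hγ.continuousAt.eventually (hρ.eventually_boxVec hs hη (hbox x) R one_pos)]
      with y hy
    exact hy.2.2
  exact hloc.apply_eq_of_preconnectedSpace x y

/-- On a small ball the transversal coordinate is constant and equals `γ x₀`; what remains is the
translation coordinate, which is continuous at `x₀`. -/
theorem IsRigid.exists_local_lift (hρ : T.IsRigid ρ) (hρ0 : 0 < ρ) {γ : E d → T.Hull}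
    (hγ : Continuous γ) (x₀ : E d) : ∃ b : E d → E d, ContinuousAt b x₀ ∧
      ∀ᶠ x in 𝓝 x₀, (γ x).1 = (γ x₀).1.shift (b x) := by
  have hmem : (γ x₀).1 ∈ box 1 (ρ / 2) (γ x₀).1 := self_mem_box (half_pos hρ0) _
  have hη : 2 * (ρ / 2) ≤ ρ := by linarith
  obtain ⟨δ, hδ, hball⟩ := Metric.mem_nhds_iff.1
    (hγ.continuousAt.eventually (box_mem_nhds_hull (s := 1) (half_pos hρ0) (γ x₀)))
  refine ⟨fun x => -boxVec 1 (ρ / 2) (γ x₀).1 (γ x).1,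
    (ContinuousAt.comp (f := γ) (hρ.continuousAt_boxVec one_pos hη hmem) hγ.continuousAt).neg, ?_⟩
  filter_upwards [Metric.ball_mem_nhds x₀ hδ] with x hx
  have : PreconnectedSpace (Metric.ball x₀ δ) :=
    Subtype.preconnectedSpace (convex_ball x₀ δ).isPreconnected
  have h := hρ.shift_boxVec_eq one_pos hη (γ := fun y : Metric.ball x₀ δ => γ y)
    (hγ.comp continuous_subtype_val) (S := (γ x₀).1) (fun y => hball y.2) ⟨x, hx⟩
    ⟨x₀, Metric.mem_ball_self hδ⟩
  simp only at h
  rw [hρ.boxVec_eq one_pos hη (γ x₀).2 (w := 0) (by simpa using hρ0) (by rw [shift_zero]),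
    shift_zero] at h
  refine Eq.trans ?_
    (congrArg (fun S => S.shift (-boxVec 1 (ρ / 2) (γ x₀).1 (γ x).1)) h)
  simp only [shift_shift, add_neg_cancel, shift_zero]

/-- The periods of a tiling. -/
def periods (S : Tiling d L) : AddSubgroup (E d) where
  carrier := {y | S.shift y = S}
  zero_mem' := S.shift_zero
  add_mem' := fun {x y} (hx : S.shift x = S) (hy : S.shift y = S) => by
    change S.shift (x + y) = S
    rw [← shift_shift, hx, hy]
  neg_mem' := fun {x} (hx : S.shift x = S) => by
    change S.shift (-x) = S
    conv_lhs => rw [← hx]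
    rw [shift_shift, add_neg_cancel, shift_zero]

theorem mem_periods {S : Tiling d L} {y : E d} : y ∈ S.periods ↔ S.shift y = S := Iff.rfl

theorem IsRigid.isDiscrete_periods (hρ : T.IsRigid ρ) (hρ0 : 0 < ρ) {S : Tiling d L}
    (hS : S ∈ T.Hull) : IsDiscrete (S.periods : Set (E d)) := by
  refine ⟨?_⟩
  rw [discreteTopology_subtype_iff']
  intro y hy
  refine ⟨Metric.ball y ρ, Metric.isOpen_ball, ?_⟩
  ext z
  constructor
  · rintro ⟨hz, hz'⟩
    have h1 : S.shift z = S.shift y := (mem_periods.1 hz').trans (mem_periods.1 hy).symm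
    refine hρ S hS 1 one_pos z y (by rw [h1]) ?_
    rwa [Metric.mem_ball, dist_eq_norm] at hz
  · rintro rfl
    exact ⟨Metric.mem_ball_self hρ0, hy⟩

/-- A continuous map from `ℝ^d` to the hull lifts to a leaf. -/
theorem IsRigid.exists_leaf_lift (hρ : T.IsRigid ρ) (hρ0 : 0 < ρ) {γ : E d → T.Hull}
    (hγ : Continuous γ) : ∃ a : E d → E d, Continuous a ∧ ∀ x, (γ x).1 = (γ 0).1.shift (a x) := by
  choose b hbc hb using hρ.exists_local_lift hρ0 hγ
  have hreach : ∀ x, ∃ y, (γ x).1 = (γ 0).1.shift y := by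
    have hloc : IsLocallyConstant fun x => ∃ y, (γ x).1 = (γ 0).1.shift y := by
      rw [IsLocallyConstant.iff_eventually_eq]
      intro x
      filter_upwards [hb x] with z hz
      refine propext ⟨?_, ?_⟩
      · rintro ⟨y, hy⟩
        refine ⟨y - b x z, ?_⟩
        rw [sub_eq_add_neg, ← shift_shift, ← hy, hz, shift_shift, add_neg_cancel, shift_zero]
      · rintro ⟨y, hy⟩
        exact ⟨y + b x z, by rw [hz, hy, shift_shift]⟩
    intro x
    have h : (∃ y, (γ x).1 = (γ 0).1.shift y) = ∃ y, (γ 0).1 = (γ 0).1.shift y :=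
      hloc.apply_eq_of_preconnectedSpace x 0
    rw [h]
    exact ⟨0, (shift_zero _).symm⟩
  choose y hy using hreach
  have hiff : ∀ z z' : E d,
      (QuotientAddGroup.mk z : E d ⧸ (γ 0).1.periods) = QuotientAddGroup.mk z' ↔
        (γ 0).1.shift z = (γ 0).1.shift z' := by
    intro z z'
    rw [QuotientAddGroup.eq, mem_periods]
    constructor
    · intro h
      conv_lhs => rw [← h]
      rw [shift_shift, neg_add_cancel_comm]
    · intro h
      rw [add_comm, ← shift_shift, ← h, shift_shift, add_neg_cancel, shift_zero]
  -- Translation vectors are unique only modulo periods. The local lifts make their classes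
  -- continuous, and since the periods are discrete the quotient map is a covering, through which
  -- `β` lifts from `ℝ^d`.
  let β : E d → E d ⧸ (γ 0).1.periods := fun x => QuotientAddGroup.mk (y x)
  have hβ : Continuous β := by
    rw [continuous_iff_continuousAt]
    intro x
    have h1 : ContinuousAt
        (fun z => (QuotientAddGroup.mk (y x + b x z) : E d ⧸ (γ 0).1.periods)) x :=
      ContinuousAt.comp (f := fun z => y x + b x z)
        (QuotientAddGroup.continuous_mk).continuousAt (continuousAt_const.add (hbc x))
    refine h1.congr ?_
    filter_upwards [hb x] with z hz
    rw [hiff, ← shift_shift, ← hy, ← hz, ← hy]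
  have cov := (AddSubgroup.isAddQuotientCoveringMap_of_comm (γ 0).1.periods
    (hρ.isDiscrete_periods hρ0 (γ 0).2)).isCoveringMap
  obtain ⟨a, ⟨-, ha⟩, -⟩ := cov.existsUnique_continuousMap_lifts ⟨β, hβ⟩ 0 (y 0) rfl
  refine ⟨a, a.continuous, fun x => ?_⟩
  rw [hy x]
  exact ((hiff _ _).1 (congrFun ha x)).symm

end Tiling

open Tiling

/-- Pullbacks along maps that differ by small translations are cohomologous. -/
theorem cohomologous_of_gap {G : Type u} [Group G] {ρ : ℝ} (hρ : T.IsRigid ρ) (hρ0 : 0 < ρ)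
    {X : Type*} [TopologicalSpace X] (f g : C(X, T.Hull))
    (hfg : ∀ x, ∃ w : E d, ‖w‖ < ρ / 4 ∧ (g x).1 = (f x).1.shift w) (C : FlatCocycle T.Hull G) :
    FlatCocycle.Cohomologous (C.pullback f) (C.pullback g) := by
  choose w hw hgw using hfg
  have hwc : Continuous w := hρ.continuous_gap hρ0 f.continuous g.continuous hw hgw
  -- The homotopy slides `f x` along its leaf by the fraction `t` of the gap.
  refine C.cohomologous_of_homotopy
    ⟨fun p => hullShift (f p.2) ((p.1 : ℝ) • w p.2), continuous_hullShift.comp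
      ((f.continuous.comp continuous_snd).prodMk
        ((continuous_subtype_val.comp continuous_fst).smul (hwc.comp continuous_snd)))⟩ f g
    (fun x => ?_) fun x => ?_
  · simp [hullShift_zero]
  · refine Subtype.ext ?_
    simp [hullShift, hgw]

/-! ### Local partitions of unity and local approximation -/

namespace Tiling

variable {ρ : ℝ}

theorem continuous_hullShift_right (S : T.Hull) : Continuous fun x => hullShift S x :=
  continuous_hullShift.comp (continuous_const.prodMk continuous_id)

/-- A local bump function on the hull, supported in a box and smooth along the leaves. -/
theorem IsRigid.exists_bump (hρ : T.IsRigid ρ) {s η : ℝ} (hs : 0 < s) (hη0 : 0 < η)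
    (hη : 2 * η ≤ ρ) (S₀ : T.Hull) : ∃ ψ : T.Hull → ℝ, (∀ S, 0 ≤ ψ S) ∧
      (∀ S : T.Hull, S.1 ∈ box s (η / 2) S₀.1 → 0 < ψ S) ∧
      (∀ S : T.Hull, S.1 ∈ box s η S₀.1 ∨ ∀ᶠ S' in 𝓝 S, ψ S' = 0) ∧ Continuous ψ ∧
      (∀ S : T.Hull, ContDiff ℝ ∞ fun x => ψ (hullShift S x)) ∧
      ∀ S₁ S₂ : T.Hull, S₁.1.patch (s + η) = S₂.1.patch (s + η) → ψ S₁ = ψ S₂ := by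
  classical
  -- The outer radius `η / 2` gives positivity on the half box and leaves a margin inside the box,
  -- so that the bump vanishes near every tiling outside it.
  let B : ContDiffBump (0 : E d) := ⟨η / 4, η / 2, by linarith, by linarith⟩
  let ψ : T.Hull → ℝ := fun S => if S.1 ∈ box s η S₀.1 then B (boxVec s η S₀.1 S.1) else 0
  have hin : ∀ {S : T.Hull}, S.1 ∈ box s η S₀.1 → ψ S = B (boxVec s η S₀.1 S.1) :=
    fun h => if_pos h
  have hpos : ∀ v : E d, 0 < B v ↔ ‖v‖ < η / 2 := by
    intro v
    constructor
    · intro h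
      have : v ∈ Function.support B := h.ne'
      rw [B.support_eq] at this
      simpa using this
    · intro h
      exact B.pos_of_mem_ball (by simpa using h)
  have hout : ∀ S : T.Hull, S.1 ∈ box s η S₀.1 ∨ ∀ᶠ S' in 𝓝 S, ψ S' = 0 := by
    intro S
    by_cases h : S.1 ∈ box s η S₀.1
    · exact Or.inl h
    refine Or.inr ?_
    filter_upwards [box_mem_nhds_hull (s := s + η) (half_pos hη0) S] with S' ⟨w, hw, hS'⟩
    by_contra hne
    have hbox : S'.1 ∈ box s η S₀.1 := by
      by_contra h'
      exact hne (if_neg h')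
    rw [hin hbox] at hne
    have hv := (hpos _).1 (lt_of_le_of_ne B.nonneg (Ne.symm hne))
    have hv2 := (boxVec_spec hbox).2
    set v := boxVec s η S₀.1 S'.1
    refine h ⟨v - w, by linarith [norm_sub_le v w], ?_⟩
    rw [← patch_shift_congr (w := v - w) (s := s) hS' (by linarith [norm_sub_le v w]), shift_shift,
      add_sub_cancel, hv2]
  have hcont : Continuous ψ := by
    rw [continuous_iff_continuousAt]
    intro S
    rcases hout S with h | h
    · refine (ContinuousAt.comp (f := fun S' : T.Hull => boxVec s η S₀.1 S'.1)
        B.continuous.continuousAt (hρ.continuousAt_boxVec hs hη h)).congr ?_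
      filter_upwards [hρ.eventually_boxVec hs hη h 0 one_pos] with S' hS'
      exact (hin hS'.1).symm
    · refine continuousAt_const.congr (f := fun _ => (0 : ℝ)) ?_
      filter_upwards [h] with S' hS' using hS'.symm
  refine ⟨ψ, fun S => ?_, fun S hS => ?_, hout, hcont, fun S => ?_, fun S₁ S₂ h => ?_⟩
  · by_cases h : S.1 ∈ box s η S₀.1
    · rw [hin h]
      exact B.nonneg
    · exact (if_neg h).ge
  · obtain ⟨w, hw, hS'⟩ := hS
    have hw' : ‖w‖ < η := by linarith
    rw [hin ⟨w, hw', hS'⟩, hρ.boxVec_eq hs hη S.2 hw' hS']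
    exact (hpos w).2 hw
  · rw [contDiff_iff_contDiffAt]
    intro x₀
    rcases hout (hullShift S x₀) with h | h
    · obtain ⟨hv, hv2⟩ := boxVec_spec h
      set v := boxVec s η S₀.1 (hullShift S x₀).1
      -- Along a leaf the translation coordinate is affine with slope `-1`.
      have hB : ContDiffAt ℝ ∞ (fun x => B (v - (x - x₀))) x₀ := by
        have := B.contDiff (n := ⊤)
        exact (this.comp (by fun_prop : ContDiff ℝ ∞ fun x : E d => v - (x - x₀))).contDiffAt
      refine hB.congr_of_eventuallyEq ?_
      have hc : ContinuousAt (fun x : E d => ‖v - (x - x₀)‖) x₀ := by fun_prop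
      have hlt : ‖v - (x₀ - x₀)‖ < η := by simpa using hv
      filter_upwards [hc.eventually_lt_const hlt] with x hx
      have he : ((hullShift S x).1.shift (v - (x - x₀))).patch s = S₀.1.patch s := by
        rw [← hv2]
        simp only [hullShift, shift_shift]
        rw [show x + (v - (x - x₀)) = x₀ + v by abel]
      rw [hin ⟨_, hx, he⟩, hρ.boxVec_eq hs hη (hullShift S x).2 hx he]
    · refine (contDiffAt_const (c := (0 : ℝ))).congr_of_eventuallyEq ?_
      exact (continuous_hullShift_right S).continuousAt.eventually h
  · obtain ⟨h1, h2⟩ := box_boxVec_congr (S := S₀.1) h le_rfl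
    simp only [ψ, h1, h2]

/-- Uniform continuity of a map between hulls. -/
theorem FLC.exists_uniform_radius (hT : T.FLC) {f : T.Hull → T'.Hull} (hf : Continuous f) (σ : ℝ)
    {η : ℝ} (hη : 0 < η) : ∃ r > 0, ∀ S₁ S₂ : T.Hull, S₁.1.patch r = S₂.1.patch r →
      ∃ w : E d, ‖w‖ < η ∧ ((f S₂).1.shift w).patch σ = (f S₁).1.patch σ := by
  obtain ⟨r, hr, h⟩ := hT.exists_lebesgue_radius
    (fun S => {S' | (f S').1 ∈ box (σ + η) (η / 2) (f S).1}) fun S =>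
      hf.continuousAt.eventually (box_mem_nhds_hull (half_pos hη) (f S))
  refine ⟨r, hr, fun S₁ S₂ h12 => ?_⟩
  obtain ⟨S₀, hS₀⟩ := h S₁
  obtain ⟨w₁, hw₁, e₁⟩ := hS₀ S₁ rfl
  obtain ⟨w₂, hw₂, e₂⟩ := hS₀ S₂ h12.symm
  refine ⟨w₂ - w₁, by linarith [norm_sub_le w₂ w₁], ?_⟩
  have e3 := patch_shift_congr (w := -w₁) (s := σ) (e₂.trans e₁.symm)
    (by rw [norm_neg]; linarith)
  rwa [shift_shift, shift_shift, add_neg_cancel, shift_zero, ← sub_eq_add_neg] at e3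

/-- A smooth partition of unity on the hull by local functions, subordinate to a given cover. -/
theorem FLC.exists_partition (hT : T.FLC) (W : T.Hull → Set T.Hull) (hW : ∀ S, W S ∈ 𝓝 S) :
    ∃ (t : Finset T.Hull) (φ : T.Hull → T.Hull → ℝ) (r : ℝ), (∀ n S, 0 ≤ φ n S) ∧
      (∀ S, ∑ n ∈ t, φ n S = 1) ∧ (∀ n S, W n ∈ 𝓝 S ∨ ∀ᶠ S' in 𝓝 S, φ n S' = 0) ∧
      (∀ n, Continuous (φ n)) ∧ (∀ n S, ContDiff ℝ ∞ fun x => φ n (hullShift S x)) ∧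
      ∀ n ∈ t, ∀ S₁ S₂ : T.Hull, S₁.1.patch r = S₂.1.patch r → φ n S₁ = φ n S₂ := by
  have := hT.compactSpace_hull
  obtain ⟨ρ, hρ0, hρ⟩ : ∃ ρ > 0, T.IsRigid ρ := hT.rigid
  choose s hs η₀ hη₀ hbox using fun S => exists_box_subset_hull (hW S)
  -- The cap `ρ / 2` keeps translation coordinates unique.
  let η : T.Hull → ℝ := fun S => min (η₀ S) (ρ / 2)
  have hη : ∀ S, 0 < η S := fun S => lt_min (hη₀ S) (half_pos hρ0)
  have hηρ : ∀ S, 2 * η S ≤ ρ := fun S => by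
    have := min_le_right (η₀ S) (ρ / 2)
    simp only [η]
    linarith
  choose ψ h0 hpos hsupp hcont hsmooth hloc using fun S => hρ.exists_bump (hs S) (hη S) (hηρ S) S
  obtain ⟨t, ht⟩ := isCompact_univ.elim_nhds_subcover
    (fun S : T.Hull => {S' | S'.1 ∈ box (s S) (η S / 2) S.1})
    fun S _ => box_mem_nhds_hull (half_pos (hη S)) S
  have hsum : ∀ S, 0 < ∑ n ∈ t, ψ n S := by
    intro S
    obtain ⟨n, hn, hS⟩ := mem_iUnion₂.1 (ht.2 (mem_univ S))
    exact Finset.sum_pos' (fun n _ => h0 n S) ⟨n, hn, hpos n S hS⟩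
  obtain ⟨r, hr⟩ := (t.image fun n => s n + η n).exists_le
  refine ⟨t, fun n S => ψ n S / ∑ m ∈ t, ψ m S, r, fun n S => div_nonneg (h0 n S) (hsum S).le,
    fun S => ?_, fun n S => ?_, fun n => ?_, fun n S => ?_, fun n hn S₁ S₂ h => ?_⟩
  · rw [← Finset.sum_div, div_self (hsum S).ne']
  · rcases hsupp n S with h | h
    · left
      filter_upwards [continuous_subtype_val.continuousAt ((isOpen_box _ _ _).mem_nhds h)]
        with S' hS'
      exact hbox n S' (box_mono le_rfl (min_le_left _ _) _ hS')
    · right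
      filter_upwards [h] with S' hS'
      rw [hS', zero_div]
  · exact (hcont n).div (continuous_finsetSum t fun m _ => hcont m) fun S => (hsum S).ne'
  · exact (hsmooth n S).div (ContDiff.sum fun m _ => hsmooth m S) fun x => (hsum _).ne'
  · have hψ : ∀ m ∈ t, ψ m S₁ = ψ m S₂ := fun m hm =>
      hloc m S₁ S₂ (patch_eq_of_le (hr _ (Finset.mem_image_of_mem _ hm)) h)
    simp only
    rw [hψ n hn, Finset.sum_congr rfl hψ]

end Tiling

/-- Continuous maps of tiling spaces are approximated by local maps that are smooth along the
leaves. -/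
theorem exists_isLocalApprox (hT : T.FLC) (hT' : T'.FLC) {f : T.Hull → T'.Hull} (hf : Continuous f)
    {ε : ℝ} (hε : 0 < ε) : ∃ g : T.Hull → T'.Hull, IsLocalApprox f ε g ∧ IsLeafwiseSmooth g := by
  obtain ⟨ρ, hρ0, hρ⟩ : ∃ ρ > 0, T'.IsRigid ρ := hT'.rigid
  set δ := min ε (ρ / 4)
  have hδ : 0 < δ := lt_min hε (by linarith)
  have hδρ : δ ≤ ρ / 4 := min_le_right _ _
  have hδ2 : 2 * δ ≤ ρ := by linarith
  obtain ⟨t, φ, r, hφ0, hφ1, hφW, hφc, hφs, hφl⟩ := hT.exists_partition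
    (fun n => {S | (f S).1 ∈ box 1 δ (f n).1}) fun n =>
      hf.continuousAt.eventually (box_mem_nhds_hull hδ (f n))
  replace hφW : ∀ n S, (∀ᶠ S' in 𝓝 S, (f S').1 ∈ box 1 δ (f n).1) ∨ ∀ᶠ S' in 𝓝 S, φ n S' = 0 :=
    hφW
  let u : T.Hull → T.Hull → E d := fun n S => boxVec 1 δ (f n).1 (f S).1
  have hW : ∀ n S, φ n S ≠ 0 → (f S).1 ∈ box 1 δ (f n).1 := by
    intro n S hne
    rcases hφW n S with h | h
    · exact h.self_of_nhds
    · exact absurd h.self_of_nhds hne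
  -- Each `u n S` carries `f S` to agree with the centre `f n` near the origin; averaging keeps the
  -- norm below `δ` by convexity of the ball.
  let U : T.Hull → E d := fun S => ∑ n ∈ t, φ n S • u n S
  have hU : ∀ S, ‖U S‖ < δ := by
    intro S
    have := (convex_ball (0 : E d) δ).sum_mem (t := t) (w := fun n => φ n S) (z := fun n => u n S)
      (fun n _ => hφ0 n S) (hφ1 S) fun n _ => by
        rw [mem_ball_zero_iff]
        exact norm_boxVec_lt hδ _ _
    simpa using this
  have hUc : Continuous U := by
    refine continuous_finsetSum t fun n _ => ?_
    rw [continuous_iff_continuousAt]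
    intro S
    rcases hφW n S with h | h
    · refine (hφc n).continuousAt.smul ?_
      exact ContinuousAt.comp (f := f) (hρ.continuousAt_boxVec one_pos hδ2 (h.self_of_nhds))
        hf.continuousAt
    · refine continuousAt_const.congr (f := fun _ => (0 : E d)) ?_
      filter_upwards [h] with S' hS'
      rw [hS', zero_smul]
  refine ⟨fun S => hullShift (f S) (U S), ⟨?_, fun s hs => ?_, fun S => ?_⟩, fun S => ?_⟩
  · exact continuous_hullShift.comp (hf.prodMk hUc)
  · obtain ⟨r', hr', hunif⟩ := hT.exists_uniform_radius hf (max s 1 + δ) (η := ρ / 4) (by linarith)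
    refine ⟨max r r', lt_of_lt_of_le hr' (le_max_right _ _), fun S₁ S₂ h => ?_⟩
    obtain ⟨w, hw, he⟩ := hunif S₁ S₂ (patch_eq_of_le (le_max_right _ _) h)
    have hφeq : ∀ n ∈ t, φ n S₁ = φ n S₂ := fun n hn =>
      hφl n hn S₁ S₂ (patch_eq_of_le (le_max_left _ _) h)
    -- A hidden translation `w` between `f S₁` and `f S₂` enters every relevant vector equally. The
    -- weights are local and sum to `1`, so `U` absorbs `w` exactly and the corrected map is local.
    have hterm : ∀ n ∈ t, φ n S₂ • u n S₂ = φ n S₁ • w + φ n S₁ • u n S₁ := by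
      intro n hn
      rw [← hφeq n hn]
      by_cases hne : φ n S₁ = 0
      · simp [hne]
      have b1 := boxVec_spec (hW n S₁ hne)
      have b2 := boxVec_spec (hW n S₂ (hφeq n hn ▸ hne))
      have e1 : ((f S₂).1.shift (w + u n S₁)).patch 1 = (f n).1.patch 1 := by
        rw [← b1.2, ← shift_shift]
        exact patch_shift_congr he (by linarith [le_max_right s 1, b1.1])
      have e2 : u n S₂ = w + u n S₁ := by
        refine hρ _ (f S₂).2 1 one_pos _ _ (b2.2.trans e1.symm) ?_
        have := norm_sub_le (u n S₂) (w + u n S₁)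
        have := norm_add_le w (u n S₁)
        have h1 : ‖u n S₁‖ < δ := b1.1
        have h2 : ‖u n S₂‖ < δ := b2.1
        linarith
      rw [e2, smul_add]
    have hUeq : U S₂ = w + U S₁ := by
      simp only [U]
      rw [Finset.sum_congr rfl hterm, Finset.sum_add_distrib, ← Finset.sum_smul, hφ1, one_smul]
    simp only [hullShift]
    rw [hUeq, ← shift_shift]
    exact (patch_shift_congr he (by linarith [le_max_left s 1, hU S₁])).symm
  · exact ⟨U S, (hU S).trans_le (min_le_left _ _), rfl⟩
  · obtain ⟨a, hac, ha⟩ := hρ.exists_leaf_lift hρ0 (hf.comp (continuous_hullShift_right S))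
    simp only [Function.comp_apply, hullShift_zero] at ha
    refine ⟨fun x => a x + U (hullShift S x) - U S, ?_, fun x S₁ hS₁ => ?_⟩
    · have heq : ∀ x, a x + U (hullShift S x) =
          ∑ n ∈ t, φ n (hullShift S x) • (a x + u n (hullShift S x)) := by
        intro x
        simp only [smul_add]
        rw [Finset.sum_add_distrib, ← Finset.sum_smul, hφ1, one_smul]
      simp only [heq]
      refine ContDiff.sub (ContDiff.sum fun n _ => ?_) contDiff_const
      rw [contDiff_iff_contDiffAt]
      intro x₀
      rcases hφW n (hullShift S x₀) with h | h
      · refine ((hφs n S).smul (contDiff_const (c := a x₀ + u n (hullShift S x₀)))).contDiffAt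
          |>.congr_of_eventuallyEq ?_
        have hcx : ContinuousAt (fun x => a x + u n (hullShift S x)) x₀ := by
          refine hac.continuousAt.add ?_
          exact ContinuousAt.comp (f := fun x => f (hullShift S x))
            (hρ.continuousAt_boxVec one_pos hδ2 (h.self_of_nhds))
            (hf.comp (continuous_hullShift_right S)).continuousAt
        have hpatch : ∀ x, (f (hullShift S x)).1 ∈ box 1 δ (f n).1 →
            ((f S).1.shift (a x + u n (hullShift S x))).patch 1 = (f n).1.patch 1 := by
          intro x hx
          rw [← shift_shift, ← ha]
          exact (boxVec_spec hx).2
        filter_upwards [hcx (Metric.ball_mem_nhds _ hρ0),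
          (continuous_hullShift_right S).continuousAt h] with x hx hxW
        have : a x + u n (hullShift S x) = a x₀ + u n (hullShift S x₀) := by
          refine hρ _ (f S).2 1 one_pos _ _
            ((hpatch x hxW).trans (hpatch x₀ (h.self_of_nhds)).symm) ?_
          rw [← dist_eq_norm]
          exact hx
        rw [this]
        rfl
      · refine (contDiffAt_const (c := (0 : E d))).congr_of_eventuallyEq ?_
        filter_upwards [(continuous_hullShift_right S).continuousAt.eventually h] with x hx
        rw [hx, zero_smul]
    · obtain rfl : S₁ = hullShift S x := Subtype.ext hS₁
      simp only [hullShift] at ha ⊢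
      rw [ha, shift_shift, shift_shift, add_sub_cancel]

/-! ### The induced bijection -/

variable {G : Type u} [Group G] [TopologicalSpace G]

/-- Pullbacks along a local approximation represent the Čech pullback along the map itself. -/
theorem IsPullback.cohomologous_of_approx (hT : T.FLC) (hT' : T'.FLC) {ρ : ℝ}
    (hρ : T'.IsRigid ρ) (hρ0 : 0 < ρ) (f : C(T.Hull, T'.Hull)) {g : T.Hull → T'.Hull} {ε : ℝ}
    (hε : ε ≤ ρ / 4) (hg : IsLocalApprox f ε g) {P' : FlatPEBundle T' G} {P : FlatPEBundle T G}
    (h : IsPullback g P' P) :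
    FlatCocycle.Cohomologous (P.cech hT) ((P'.cech hT').pullback f) := by
  refine (h.cohomologous hT hT' hg.continuous hg.isLocal).trans
    (cohomologous_of_gap hρ hρ0 f ⟨g, hg.continuous⟩ (fun S => ?_) _).symm
  obtain ⟨w, hw, he⟩ := hg.gap S
  exact ⟨w, hw.trans_le hε, he⟩

theorem PREP.mk_eq_iff [ContinuousMul G] (hT : T.FLC) (P R : FlatPEBundle T G) :
    PREP.mk P = PREP.mk R ↔ FlatCocycle.Cohomologous (P.cech hT) (R.cech hT) :=
  Quotient.eq.trans ⟨fun h => FlatPEBundle.Equivalent.cohomologous hT h,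
    fun h => FlatPEBundle.equivalent_of_cohomologous hT h⟩

/-- A local approximation of `f` is used only to find a bundle whose cocycle represents the class
pulled back along `f`. Injectivity follows by pulling back along `f.symm`; surjectivity also needs a
local approximation of `f.symm`. -/
theorem exists_prep_equiv [ContinuousMul G] (hT : T.FLC) (hT' : T'.FLC)
    (f : T.Hull ≃ₜ T'.Hull) : ∃ Φ : PREP T' G ≃ PREP T G, ∀ P' P,
      FlatCocycle.Cohomologous (P.cech hT) ((P'.cech hT').pullback (f : C(T.Hull, T'.Hull))) →
        Φ (PREP.mk P') = PREP.mk P := by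
  obtain ⟨ρ, hρ0, hρ⟩ : ∃ ρ > 0, T.IsRigid ρ := hT.rigid
  obtain ⟨ρ', hρ0', hρ'⟩ : ∃ ρ > 0, T'.IsRigid ρ := hT'.rigid
  obtain ⟨g, hg, -⟩ := exists_isLocalApprox hT hT' f.continuous (show 0 < ρ' / 4 by linarith)
  obtain ⟨g', hg', -⟩ := exists_isLocalApprox hT' hT f.symm.continuous (show 0 < ρ / 4 by linarith)
  have hpb : ∀ P' : FlatPEBundle T' G, ∃ P : FlatPEBundle T G,
      FlatCocycle.Cohomologous (P.cech hT) ((P'.cech hT').pullback (f : C(T.Hull, T'.Hull))) := by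
    intro P'
    obtain ⟨P, hP⟩ := exists_isPullback hT' hg.continuous hg.isLocal P'
    exact ⟨P, hP.cohomologous_of_approx hT hT' hρ' hρ0' (f : C(T.Hull, T'.Hull)) le_rfl hg⟩
  have hpb' : ∀ P : FlatPEBundle T G, ∃ P' : FlatPEBundle T' G,
      FlatCocycle.Cohomologous (P'.cech hT')
        ((P.cech hT).pullback (f.symm : C(T'.Hull, T.Hull))) := by
    intro P
    obtain ⟨P', hP'⟩ := exists_isPullback hT hg'.continuous hg'.isLocal P
    exact ⟨P', hP'.cohomologous_of_approx hT' hT hρ hρ0 (f.symm : C(T'.Hull, T.Hull)) le_rfl hg'⟩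
  choose pb hpb using hpb
  let Φ : PREP T' G → PREP T G := Quotient.lift (fun P' => PREP.mk (pb P')) fun P' R' h =>
    (PREP.mk_eq_iff hT _ _).2 (((hpb P').trans
      ((FlatPEBundle.Equivalent.cohomologous hT' h).pullback _)).trans (hpb R').symm)
  have hΦ : ∀ P' P, FlatCocycle.Cohomologous (P.cech hT)
      ((P'.cech hT').pullback (f : C(T.Hull, T'.Hull))) → Φ (PREP.mk P') = PREP.mk P :=
    fun P' P h => (PREP.mk_eq_iff hT _ _).2 ((hpb P').trans h.symm)
  refine ⟨Equiv.ofBijective Φ ⟨?_, ?_⟩, hΦ⟩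
  · rintro ⟨P'⟩ ⟨R'⟩ h
    have h1 := (PREP.mk_eq_iff hT (pb P') (pb R')).1 h
    have h2 := (((hpb P').symm.trans h1).trans (hpb R')).pullback (f.symm : C(T'.Hull, T.Hull))
    refine (PREP.mk_eq_iff hT' P' R').2 ?_
    exact ((FlatCocycle.cohomologous_pullback_pullback _ _ _ fun x => by simp).symm.trans h2).trans
      (FlatCocycle.cohomologous_pullback_pullback _ _ _ fun x => by simp)
  · rintro ⟨P⟩
    obtain ⟨P', hP'⟩ := hpb' P
    refine ⟨PREP.mk P', hΦ P' P ?_⟩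
    exact ((hP'.pullback (f : C(T.Hull, T'.Hull))).trans
      (FlatCocycle.cohomologous_pullback_pullback _ _ _ fun x => by simp)).symm

end PETiling

theorem mainTheorem3 {d : ℕ} {L : Type*} {L' : Type*} (T : Tiling d L) (T' : Tiling d L')
    (hT : T.FLC) (hT' : T'.FLC)
    (G : Type*) [Group G] [TopologicalSpace G] [IsTopologicalGroup G]
    (f : T.Hull ≃ₜ T'.Hull) :
    ∃ Φ : PREP T' G ≃ PREP T G, ∃ ε₀ : ℝ, 0 < ε₀ ∧ ∀ ε : ℝ, 0 < ε → ε ≤ ε₀ →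
      (∃ g : T.Hull → T'.Hull, IsLocalApprox f ε g ∧ IsLeafwiseSmooth g) ∧
      ∀ g : T.Hull → T'.Hull, IsLocalApprox f ε g →
        (∀ P' : FlatPEBundle T' G, (∃ P : FlatPEBundle T G, IsPullback g P' P) ∧
          ∀ P : FlatPEBundle T G, IsPullback g P' P → Φ (PREP.mk P') = PREP.mk P) ∧
        (∀ a : E d → E d, Continuous a → (∀ x, (g (T.orbitPt x)).1 = T'.shift (a x)) →
          ∀ P' : FlatPEBundle T' G, (∃ P : FlatPEBundle T G, IsPullbackAlong a P' P) ∧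
            ∀ P : FlatPEBundle T G, IsPullbackAlong a P' P → Φ (PREP.mk P') = PREP.mk P) := by
  obtain ⟨Φ, hΦ⟩ := exists_prep_equiv (G := G) hT hT' f
  obtain ⟨ρ, hρ0, hρ⟩ : ∃ ρ > 0, T'.IsRigid ρ := hT'.rigid
  -- The threshold is the gap bound of `cohomologous_of_gap`, with `ρ` the rigidity constant of
  -- `T'`. `Φ` is already fixed, characterised by the cocycle pullback along `f` alone.
  refine ⟨Φ, ρ / 4, by linarith, fun ε hε hερ =>
    ⟨exists_isLocalApprox hT hT' f.continuous hε, fun g hg => ?_⟩⟩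
  have hclass : ∀ (P' : FlatPEBundle T' G) (P : FlatPEBundle T G), IsPullback g P' P →
      Φ (PREP.mk P') = PREP.mk P := fun P' P h =>
    hΦ P' P (h.cohomologous_of_approx hT hT' hρ hρ0 (f : C(T.Hull, T'.Hull)) hερ hg)
  refine ⟨fun P' => ⟨exists_isPullback hT' hg.continuous hg.isLocal P', hclass P'⟩,
    fun a ha hga P' => ⟨?_, fun P hP => hclass P' P (hP.isPullback hga)⟩⟩
  obtain ⟨P, hP⟩ := exists_isPullback (G := G) hT' hg.continuous hg.isLocal P'
  exact ⟨P, hP.isPullbackAlong ha hga⟩
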